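/- Let $R=\bigoplus_{n\ge 0}R_n$ be a standard graded algebra over an infinite field $k$ (that is, $R\neq 0$, $R_0=k$, $\dim_k R_1<\infty$ and $R=k[R_1]$), with irrelevant maximal ideal $\mathfrak m=R_+$. Let $I\subset\mathfrak m$ be a homogeneous ideal that is $d$-equigenerated, i.e. generated by $I_d:=I\cap R_d$. Let $k[I_d]\subset R$ be the $k$-subalgebra generated by $I_d$, let $\mathcal F(I)=R[It]/\mathfrak m R[It]$ be the special fiber, $\ell(I)=\dim\mathcal F(I)$ the analytic spread, and let $\mu(\cdot)$ denote the minimal number of generators of an ideal. Forms $f_1,\dots,f_l\in I_d$ are called $l$-adjusted if they are $k$-linearly independent and $\mu(IJ)=l\,\mu(I)-\binom l2$, where $J=(f_1,\dots,f_l)$; they are called analytically adjusted if moreover $l=\ell(I)$. A reduction of $I$ is an ideal $J\subset I$ with $JI^n=I^{n+1}$ for some $n\ge 0$; a minimal reduction is a homogeneous reduction of $I$ that is minimal under inclusion among the homogeneous reductions of $I$. (1) If $f_1,\dots,f_l\in I_d$ form a regular sequence in $k[I_d]$, then for every $1\le i\le l$ the set $\{f_1,\dots,f_i\}$ is $i$-adjusted.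 (2) If $\mathcal F(I)$ is Cohen--Macaulay, then every set of $\ell(I)$ forms in $I_d$ that generates a minimal reduction of $I$ is analytically adjusted. Likewise, every set of $l$ forms in $I_d$ that generates a minimal reduction $J$ of $I$ minimally, i.e. with $l=\mu(J)$, is analytically adjusted (in particular $l=\ell(I)$). -/

import Mathlib

/-- `R = ⨁ₙ 𝒜 n` is a standard graded algebra over the field `k`: it is nonzero, `R₀ = k`, and it
is generated as a `k`-algebra by its finite-dimensional degree one part. -/
structure IsStandardGraded {k R : Type*} [Field k] [CommRing R] [Algebra k R]
    (𝒜 : ℕ → Submodule k R) [GradedAlgebra 𝒜] : Prop where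
  nontrivial : Nontrivial R
  degree_zero : ∀ x ∈ 𝒜 0, ∃ c : k, algebraMap k R c = x
  degree_one_fg : (𝒜 1).FG
  adjoin_degree_one : Algebra.adjoin k (𝒜 1 : Set R) = ⊤

/-- The maximal irrelevant ideal `𝔪 = R₊`. -/
noncomputable abbrev irrelevantIdeal {k R : Type*} [Field k] [CommRing R] [Algebra k R]
    (𝒜 : ℕ → Submodule k R) [GradedAlgebra 𝒜] : Ideal R :=
  (HomogeneousIdeal.irrelevant 𝒜).toIdeal

/-- `[I]_d`, the `k`-space of the forms of degree `d` in the ideal `I`. -/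
def degPart {k R : Type*} [Field k] [CommRing R] [Algebra k R]
    (𝒜 : ℕ → Submodule k R) (I : Ideal R) (d : ℕ) : Submodule k R :=
  I.restrictScalars k ⊓ 𝒜 d

/-- `I` is `d`-equigenerated: it is generated by its forms of degree `d`. -/
def IsEquigenerated {k R : Type*} [Field k] [CommRing R] [Algebra k R]
    (𝒜 : ℕ → Submodule k R) (I : Ideal R) (d : ℕ) : Prop :=
  Ideal.span (degPart 𝒜 I d : Set R) = I

/-- The `k`-subalgebra `k[I_d]` of `R` generated by the forms of degree `d` in `I`. -/
def formAlgebra {k R : Type*} [Field k] [CommRing R] [Algebra k R]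
    (𝒜 : ℕ → Submodule k R) (I : Ideal R) (d : ℕ) : Subalgebra k R :=
  Algebra.adjoin k (degPart 𝒜 I d : Set R)

/-- The special fiber (fiber cone) `ℱ(I)`, the quotient of the Rees algebra `R[It]` of `I` by the
extension of the irrelevant ideal `𝔪`. -/
abbrev SpecialFiber {k R : Type*} [Field k] [CommRing R] [Algebra k R]
    (𝒜 : ℕ → Submodule k R) [GradedAlgebra 𝒜] (I : Ideal R) : Type _ :=
  reesAlgebra I ⧸ (irrelevantIdeal 𝒜).map (algebraMap R (reesAlgebra I))

/-- The analytic spread `ℓ(I)`, the Krull dimension of the special fiber. -/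
noncomputable def analyticSpread {k R : Type*} [Field k] [CommRing R] [Algebra k R]
    (𝒜 : ℕ → Submodule k R) [GradedAlgebra 𝒜] (I : Ideal R) : WithBot ℕ∞ :=
  ringKrullDim (SpecialFiber 𝒜 I)

/-- The minimal number of generators `μ(I)` of an ideal. -/
noncomputable def minGens {R : Type*} [CommRing R] (I : Ideal R) : ℕ :=
  Submodule.spanFinrank I

/-- The depth of a local ring: the supremum of the lengths of the regular sequences in its maximal
ideal. -/
noncomputable def localDepth (A : Type*) [CommRing A] [IsLocalRing A] : ℕ∞ :=
  ⨆ (rs : List A) (_ : RingTheory.Sequence.IsRegular A rs)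
    (_ : ∀ r ∈ rs, r ∈ IsLocalRing.maximalIdeal A), (rs.length : ℕ∞)

/-- A Cohen--Macaulay ring: a Noetherian ring whose localization at every maximal ideal has depth
equal to its Krull dimension. -/
def IsCohenMacaulayRing (A : Type*) [CommRing A] : Prop :=
  IsNoetherianRing A ∧ ∀ (M : Ideal A) [M.IsMaximal],
    ((localDepth (Localization.AtPrime M) : ℕ∞) : WithBot ℕ∞) =
      ringKrullDim (Localization.AtPrime M)

/-- `J` is a reduction of `I`. -/
def IsReduction {R : Type*} [CommRing R] (J I : Ideal R) : Prop :=
  J ≤ I ∧ ∃ n : ℕ, J * I ^ n = I ^ (n + 1)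

/-- `J` is a minimal reduction of the homogeneous ideal `I` of a graded algebra: it is a
homogeneous reduction of `I`, and no homogeneous reduction of `I` is strictly contained in `J`. -/
def IsMinimalReduction {k R : Type*} [Field k] [CommRing R] [Algebra k R]
    (𝒜 : ℕ → Submodule k R) [GradedAlgebra 𝒜] (J I : Ideal R) : Prop :=
  J.IsHomogeneous 𝒜 ∧ IsReduction J I ∧
    ∀ K : Ideal R, K.IsHomogeneous 𝒜 → IsReduction K I → K ≤ J → K = J

/-- The forms `f₁, …, f_l ∈ I_d` are `l`-adjusted: they are `k`-linearly independent and
`μ(IJ) = l μ(I) - (l choose 2)`, where `J = (f₁, …, f_l)`. -/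
def IsAdjusted {k R : Type*} [Field k] [CommRing R] [Algebra k R]
    (𝒜 : ℕ → Submodule k R) (I : Ideal R) (d : ℕ) {l : ℕ} (f : Fin l → R) : Prop :=
  (∀ j, f j ∈ degPart 𝒜 I d) ∧ LinearIndependent k f ∧
    (minGens (I * Ideal.span (Set.range f)) : ℤ) = (l : ℤ) * (minGens I : ℤ) - (l.choose 2 : ℤ)

/-- The forms `f₁, …, f_l ∈ I_d` are analytically adjusted: they are `l`-adjusted and `l` is the
analytic spread of `I`. -/
def IsAnalyticallyAdjusted {k R : Type*} [Field k] [CommRing R] [Algebra k R]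
    (𝒜 : ℕ → Submodule k R) [GradedAlgebra 𝒜] (I : Ideal R) (d : ℕ) {l : ℕ}
    (f : Fin l → R) : Prop :=
  (l : WithBot ℕ∞) = analyticSpread 𝒜 I ∧ IsAdjusted 𝒜 I d f

/-! Put V = I_d and let W_i be the k-span of f_1, …, f_i. By graded Nakayama, an ideal generated by
a space of forms of one degree needs exactly as many generators as the dimension of that space, so
μ(I) = dim V and μ(IJ) = dim V·W_l. Passing from V·W_{i-1} to V·W_i adds the image of V under
multiplication by f_i modulo V·W_{i-1}. By commutativity the kernel of that map contains W_{i-1}. If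
it is no larger, the dimension grows by dim V − (i−1), and summation gives l·μ(I) − C(l,2). So
everything rests on linear independence and the colon condition: g ∈ V and g·f_i ∈ V·W_{i-1} imply g
∈ W_{i-1} (`finrank_mul_span_add_choose`, `IsStandardGraded.isAdjusted`).

For (1), regularity in k[I_d] puts g in the ideal (f_1, …, f_{i-1}), and comparing degree d puts it
in W_{i-1}.

For (2), take a minimal generating set of J. Over an infinite field, a homogeneous relation among
the f_j would allow one generator to be eliminated and still leave a reduction
(`IsMinimalReduction.eq_zero_of_aeval_eq_zero`). Hence X_j ↦ f_j t embeds k[X_1, …, X_l] in ℱ(I),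
and finitely so because J is a reduction. Thus ℓ(I) = l, and the irrelevant maximal ideal M of ℱ(I)
has height at least l. The f_j t generate an ideal with radical M, so Cohen–Macaulayness makes them
a regular sequence in ℱ(I)_M (`HasRegSeq.isRegularMod_of_primary`). Clearing denominators and
reading off the coefficient of t in degree d gives the colon condition
(`IsStandardGraded.mem_span_of_mul_mem`). -/

open IsLocalRing

/-! ### Depth and regular sequences in Noetherian local rings -/

/-- `x` is a nonzerodivisor modulo the ideal `𝔞`. -/
def IsRegularMod {B : Type*} [CommRing B] (𝔞 : Ideal B) (x : B) : Prop :=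
  ∀ b, x * b ∈ 𝔞 → b ∈ 𝔞

/-- There is a sequence of length `n` in the maximal ideal which is regular modulo `𝔞`. -/
def HasRegSeq {B : Type*} [CommRing B] [IsLocalRing B] : ℕ → Ideal B → Prop
  | 0, _ => True
  | n + 1, 𝔞 => ∃ x ∈ maximalIdeal B, IsRegularMod 𝔞 x ∧ HasRegSeq n (𝔞 ⊔ Ideal.span {x})

theorem Ideal.mem_sup_span_singleton_iff {B : Type*} [CommRing B] {𝔞 : Ideal B} {x b : B} :
    b ∈ 𝔞 ⊔ Ideal.span {x} ↔ ∃ c, b - x * c ∈ 𝔞 := by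
  rw [Submodule.mem_sup]
  constructor
  · rintro ⟨a, ha, z, hz, rfl⟩
    obtain ⟨c, rfl⟩ := Ideal.mem_span_singleton'.1 hz
    exact ⟨c, by ring_nf; exact ha⟩
  · rintro ⟨c, hc⟩
    exact ⟨_, hc, x * c, Ideal.mem_span_singleton'.2 ⟨c, mul_comm _ _⟩, by ring⟩

section Associated

variable {B : Type*} [CommRing B] [IsNoetherianRing B]

theorem mem_associatedPrimes_quotient_iff {𝔞 p : Ideal B} :
    p ∈ associatedPrimes B (B ⧸ 𝔞) ↔ p.IsPrime ∧ ∃ u, ∀ r, r ∈ p ↔ r * u ∈ 𝔞 := by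
  rw [AssociatedPrimes.mem_iff, isAssociatedPrime_iff]
  refine and_congr_right fun _ => ?_
  constructor
  · rintro ⟨x, rfl⟩
    obtain ⟨u, rfl⟩ := Ideal.Quotient.mk_surjective x
    refine ⟨u, fun r => ?_⟩
    rw [Submodule.mem_colon_singleton, Submodule.mem_bot, ← Ideal.Quotient.eq_zero_iff_mem, map_mul]
    rfl
  · rintro ⟨u, hu⟩
    refine ⟨Ideal.Quotient.mk 𝔞 u, ?_⟩
    ext r
    rw [Submodule.mem_colon_singleton, Submodule.mem_bot, hu, ← Ideal.Quotient.eq_zero_iff_mem,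
      map_mul]
    rfl

theorem exists_associatedPrime_of_notMem {𝔞 : Ideal B} {w : B} (hw : w ∉ 𝔞) :
    ∃ p ∈ associatedPrimes B (B ⧸ 𝔞), ∀ r, r * w ∈ 𝔞 → r ∈ p := by
  obtain ⟨p, hp, hle⟩ := exists_le_isAssociatedPrime_of_isNoetherianRing B
    (Ideal.Quotient.mk 𝔞 w) (by rwa [Ne, Ideal.Quotient.eq_zero_iff_mem])
  refine ⟨p, hp, fun r hr => hle ?_⟩
  rw [Submodule.mem_colon_singleton, Submodule.mem_bot]
  rw [← Ideal.Quotient.eq_zero_iff_mem, map_mul] at hr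
  exact hr

/-- The hypotheses say that the socles of B/𝔞 and B/𝔟 vanish, so the maximal ideal is associated to
neither quotient. Prime avoidance over both finite sets of associated primes then gives one z for
both. -/
theorem exists_regularMod_pair [IsLocalRing B] {𝔞 𝔟 : Ideal B}
    (ha : ∀ u, (∀ r ∈ maximalIdeal B, r * u ∈ 𝔞) → u ∈ 𝔞)
    (hb : ∀ u, (∀ r ∈ maximalIdeal B, r * u ∈ 𝔟) → u ∈ 𝔟) :
    ∃ z ∈ maximalIdeal B, IsRegularMod 𝔞 z ∧ IsRegularMod 𝔟 z := by
  have key : ∀ 𝔠 : Ideal B, (∀ u, (∀ r ∈ maximalIdeal B, r * u ∈ 𝔠) → u ∈ 𝔠) →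
      ∀ p ∈ associatedPrimes B (B ⧸ 𝔠), ¬ maximalIdeal B ≤ p := by
    intro 𝔠 hc p hp hle
    obtain ⟨hpp, u, hu⟩ := mem_associatedPrimes_quotient_iff.1 hp
    have := hc u fun r hr => (hu r).1 (hle hr)
    exact hpp.ne_top ((Ideal.eq_top_iff_one _).2 ((hu 1).2 (by simpa using this)))
  have hfin : (associatedPrimes B (B ⧸ 𝔞) ∪ associatedPrimes B (B ⧸ 𝔟)).Finite :=
    (associatedPrimes.finite _ _).union (associatedPrimes.finite _ _)
  have hnot : ¬ ((maximalIdeal B : Set B) ⊆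
      ⋃ p ∈ associatedPrimes B (B ⧸ 𝔞) ∪ associatedPrimes B (B ⧸ 𝔟), (p : Set B)) := by
    intro hsub
    obtain ⟨p, hp, hle⟩ := ((maximalIdeal B).subset_union_prime_finite hfin (f := id) 0 0
      fun p hp _ _ => by
        rcases hp with hp | hp <;> exact (mem_associatedPrimes_quotient_iff.1 hp).1).1 hsub
    rcases hp with hp | hp
    · exact key 𝔞 ha p hp hle
    · exact key 𝔟 hb p hp hle
  obtain ⟨z, hz, hz'⟩ := Set.not_subset.1 hnot
  simp only [Set.mem_iUnion, not_exists] at hz'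
  refine ⟨z, hz, fun b hzb => ?_, fun b hzb => ?_⟩ <;> by_contra hcon <;>
    obtain ⟨p, hp, h⟩ := exists_associatedPrime_of_notMem hcon
  · exact hz' p (Or.inl hp) (h z hzb)
  · exact hz' p (Or.inr hp) (h z hzb)

end Associated

/-- If xb ≡ zc modulo 𝔞, regularity of z modulo (𝔞, x) forces c ≡ xc', and cancelling x leaves b ≡
zc'. -/
theorem IsRegularMod.swap {B : Type*} [CommRing B] {𝔞 : Ideal B} {x z : B}
    (hx : IsRegularMod 𝔞 x) (hz : IsRegularMod (𝔞 ⊔ Ideal.span {x}) z) :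
    IsRegularMod (𝔞 ⊔ Ideal.span {z}) x := by
  intro b hb
  obtain ⟨c, hc⟩ := Ideal.mem_sup_span_singleton_iff.1 hb
  obtain ⟨c', hc'⟩ := Ideal.mem_sup_span_singleton_iff.1
    (hz c (Ideal.mem_sup_span_singleton_iff.2 ⟨b, by
      have := 𝔞.neg_mem hc; rwa [neg_sub] at this⟩))
  refine Ideal.mem_sup_span_singleton_iff.2 ⟨c', hx _ ?_⟩
  have : x * (b - z * c') = (x * b - z * c) + z * (c - x * c') := by ring
  rw [this]
  exact 𝔞.add_mem hc (𝔞.mul_mem_left _ hc')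

/-- The relation yu ≡ xv modulo 𝔞 carries a socle element u modulo (𝔞, x) to a socle element v
modulo (𝔞, y). When the latter is trivial, v ≡ yw, and cancelling y gives u ≡ xw. -/
theorem socle_transfer {B : Type*} [CommRing B] {𝔞 𝔪 : Ideal B} {x y : B} (hy𝔪 : y ∈ 𝔪)
    (hx : IsRegularMod 𝔞 x) (hy : IsRegularMod 𝔞 y)
    (h : ∀ u, (∀ r ∈ 𝔪, r * u ∈ 𝔞 ⊔ Ideal.span {y}) → u ∈ 𝔞 ⊔ Ideal.span {y}) :
    ∀ u, (∀ r ∈ 𝔪, r * u ∈ 𝔞 ⊔ Ideal.span {x}) → u ∈ 𝔞 ⊔ Ideal.span {x} := by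
  intro u hu
  obtain ⟨v, hv⟩ := Ideal.mem_sup_span_singleton_iff.1 (hu y hy𝔪)
  have hvy : v ∈ 𝔞 ⊔ Ideal.span {y} := by
    refine h v fun r hr => ?_
    obtain ⟨b, hb⟩ := Ideal.mem_sup_span_singleton_iff.1 (hu r hr)
    refine Ideal.mem_sup_span_singleton_iff.2 ⟨b, hx _ ?_⟩
    have : x * (r * v - y * b) = y * (r * u - x * b) - r * (y * u - x * v) := by ring
    rw [this]
    exact 𝔞.sub_mem (𝔞.mul_mem_left _ hb) (𝔞.mul_mem_left _ hv)
  obtain ⟨w, hw⟩ := Ideal.mem_sup_span_singleton_iff.1 hvy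
  refine Ideal.mem_sup_span_singleton_iff.2 ⟨w, hy _ ?_⟩
  have : y * (u - x * w) = (y * u - x * v) + x * (v - y * w) := by ring
  rw [this]
  exact 𝔞.add_mem hv (𝔞.mul_mem_left _ hw)

section Local

variable {B : Type*} [CommRing B] [IsLocalRing B] [IsNoetherianRing B]

/-- Depth drops by at most one modulo any regular element, not only modulo the first member of the
given sequence. This is an exchange argument: an auxiliary z, regular modulo both (𝔞, x) and (𝔞, y),
links the two quotients through (𝔞, z), and induction applies there. -/
theorem HasRegSeq.of_regularMod {n : ℕ} : ∀ {𝔞 : Ideal B} {y : B}, HasRegSeq (n + 1) 𝔞 →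
    y ∈ maximalIdeal B → IsRegularMod 𝔞 y → HasRegSeq n (𝔞 ⊔ Ideal.span {y}) := by
  induction n with
  | zero => intros; trivial
  | succ n ih =>
    intro 𝔞 y hreg hym hy
    obtain ⟨x, hxm, hx, x', hxm', hx', hrest⟩ := hreg
    have hsoc : ∀ u, (∀ r ∈ maximalIdeal B, r * u ∈ 𝔞 ⊔ Ideal.span {x}) →
        u ∈ 𝔞 ⊔ Ideal.span {x} := fun u hu => hx' u (hu x' hxm')
    obtain ⟨z, hzm, hzx, hzy⟩ := exists_regularMod_pair hsoc (socle_transfer hxm hy hx hsoc)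
    have h1 : HasRegSeq n (𝔞 ⊔ Ideal.span {x} ⊔ Ideal.span {z}) :=
      ih ⟨x', hxm', hx', hrest⟩ hzm hzx
    have h2 : HasRegSeq (n + 1) (𝔞 ⊔ Ideal.span {z}) :=
      ⟨x, hxm, hx.swap hzx, by rwa [sup_right_comm] at h1⟩
    have h3 := ih h2 hym (hy.swap hzy)
    exact ⟨z, hzm, hzy, by rwa [sup_right_comm] at h3⟩

/-- Depth is bounded by the dimension of every associated prime. For p associated to 𝔞 and x regular
modulo 𝔞, some prime q associated to (𝔞, x) contains p and x. As x ∉ p, the dimension of B/q is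
strictly smaller, and induction applies to q. -/
theorem HasRegSeq.le_ringKrullDim_quotient {n : ℕ} : ∀ {𝔞 : Ideal B}, HasRegSeq n 𝔞 →
    ∀ p ∈ associatedPrimes B (B ⧸ 𝔞), (n : WithBot ℕ∞) ≤ ringKrullDim (B ⧸ p) := by
  induction n with
  | zero =>
    intro 𝔞 _ p hp
    have := (mem_associatedPrimes_quotient_iff.1 hp).1
    exact_mod_cast ringKrullDim_nonneg_of_nontrivial
  | succ n ih =>
    intro 𝔞 hreg p hp
    obtain ⟨x, hxm, hx, hrest⟩ := hreg
    obtain ⟨hpp, u, hu⟩ := mem_associatedPrimes_quotient_iff.1 hp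
    have hua : u ∉ 𝔞 := fun h =>
      hpp.ne_top ((Ideal.eq_top_iff_one _).2 ((hu 1).2 (by simpa using h)))
    have hxp : x ∉ p := fun h => hua (hx u ((hu x).1 h))
    -- N = (𝔞 : p) contains u. If N were inside (𝔞, x), regularity of x would give N ≤ 𝔞 + 𝔪N, so N
    -- ≤ 𝔞 by Nakayama, against u ∉ 𝔞. An element w of N outside (𝔞, x) then provides q, which
    -- contains p because p·w ⊆ 𝔞.
    let N : Ideal B :=
      { carrier := {b | ∀ r ∈ p, r * b ∈ 𝔞}
        add_mem' := fun {a b} ha hb r hr => by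
          rw [mul_add]; exact 𝔞.add_mem (ha r hr) (hb r hr)
        zero_mem' := fun r _ => by simp
        smul_mem' := fun c b hb r hr => by
          rw [smul_eq_mul, mul_left_comm]; exact 𝔞.mul_mem_left _ (hb r hr) }
    have hN : ¬ N ≤ 𝔞 ⊔ Ideal.span {x} := by
      intro hle
      have hle' : N ≤ 𝔞 ⊔ maximalIdeal B • N := by
        intro b hb
        obtain ⟨c, hc⟩ := Ideal.mem_sup_span_singleton_iff.1 (hle hb)
        have hcN : c ∈ N := fun r hr => hx _ (by
          have : x * (r * c) = r * b - r * (b - x * c) := by ring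
          rw [this]
          exact 𝔞.sub_mem (hb r hr) (𝔞.mul_mem_left _ hc))
        rw [← sub_add_cancel b (x * c)]
        exact Submodule.add_mem_sup hc (Submodule.smul_mem_smul hxm hcN)
      have := Submodule.le_of_le_smul_of_le_jacobson_bot (IsNoetherian.noetherian N)
        (maximalIdeal_le_jacobson _) hle'
      exact hua (this fun r hr => (hu r).1 hr)
    obtain ⟨w, hwN, hw⟩ := SetLike.not_le_iff_exists.1 hN
    obtain ⟨q, hq, hqw⟩ := exists_associatedPrime_of_notMem hw
    have hpq : p ≤ q := fun r hr => hqw r (Ideal.mem_sup_left (hwN r hr))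
    have hxq : x ∈ q := hqw x (Ideal.mem_sup_right
      (Ideal.mul_mem_right _ _ (Ideal.mem_span_singleton_self x)))
    have hstep := ringKrullDim_succ_le_of_surjective (Ideal.Quotient.factor hpq)
      (Ideal.Quotient.factor_surjective hpq) (r := Ideal.Quotient.mk p x)
      (mem_nonZeroDivisors_of_ne_zero (by rwa [Ne, Ideal.Quotient.eq_zero_iff_mem]))
      (by rw [Ideal.Quotient.factor_mk]; exact Ideal.Quotient.eq_zero_iff_mem.2 hxq)
    have hn := ih hrest q hq
    push_cast
    exact (add_le_add_left hn 1).trans hstep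

/-- Krull's height theorem in B/p, whose maximal ideal is minimal over the images of `ys`. -/
theorem ringKrullDim_quotient_le_length {p : Ideal B} [p.IsPrime] (ys : List B)
    (hys : ∀ y ∈ ys, y ∈ maximalIdeal B)
    (hm : maximalIdeal B ≤ (p ⊔ Ideal.ofList ys).radical) :
    ringKrullDim (B ⧸ p) ≤ ys.length := by
  classical
  have hpm : p ≤ maximalIdeal B := le_maximalIdeal (Ideal.IsPrime.ne_top ‹_›)
  have : IsLocalRing (B ⧸ p) := .of_surjective' _ Ideal.Quotient.mk_surjective
  rw [← maximalIdeal_height_eq_ringKrullDim]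
  let s : Finset (B ⧸ p) := (ys.map (Ideal.Quotient.mk p)).toFinset
  have hs : Ideal.span (s : Set (B ⧸ p)) = (Ideal.ofList ys).map (Ideal.Quotient.mk p) := by
    rw [Ideal.map_ofList, Ideal.ofList]
    congr 1
    ext; simp [s]
  have hmax : (maximalIdeal B).map (Ideal.Quotient.mk p) = maximalIdeal (B ⧸ p) :=
    map_maximalIdeal_of_surjective _ Ideal.Quotient.mk_surjective
  have hmin : maximalIdeal (B ⧸ p) ∈ (Ideal.span (s : Set (B ⧸ p))).minimalPrimes := by
    refine ⟨⟨inferInstance, ?_⟩, fun q hq _ => ?_⟩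
    · rw [hs, ← hmax]
      refine Ideal.map_mono ?_
      rw [Ideal.ofList, Ideal.span_le]
      exact fun y hy => hys y hy
    · rw [← hmax, Ideal.map_le_iff_le_comap]
      have := hq.1
      refine hm.trans ((Ideal.IsPrime.radical_le_iff inferInstance).2 (sup_le ?_ ?_))
      · intro r hr
        rw [Ideal.mem_comap, Ideal.Quotient.eq_zero_iff_mem.2 hr]
        exact q.zero_mem
      · rw [← Ideal.map_le_iff_le_comap, ← hs]
        exact hq.2
  have h1 := Ideal.height_le_card_of_mem_minimalPrimes_span_finset hmin
  have h2 : s.card ≤ ys.length := (List.toFinset_card_le _).trans (by simp)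
  exact_mod_cast h1.trans (by exact_mod_cast h2)

theorem HasRegSeq.isRegularMod_of_primary : ∀ (ys : List B) (𝔞 : Ideal B),
    HasRegSeq ys.length 𝔞 → (∀ y ∈ ys, y ∈ maximalIdeal B) →
    maximalIdeal B ≤ (𝔞 ⊔ Ideal.ofList ys).radical →
    ∀ i (h : i < ys.length), IsRegularMod (𝔞 ⊔ Ideal.ofList (ys.take i)) ys[i] := by
  intro ys
  induction ys with
  | nil => intro _ _ _ _ i h; simp at h
  | cons y ys ih =>
    intro 𝔞 hreg hmem hrad
    -- A zerodivisor y would lie in an associated prime p. The tail alone would then generate a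
    -- primary ideal modulo p, so dim B/p ≤ `ys.length`, one less than the depth bound allows.
    have hy : IsRegularMod 𝔞 y := by
      intro b hb
      by_contra hb'
      obtain ⟨p, hp, h⟩ := exists_associatedPrime_of_notMem hb'
      have hle := hreg.le_ringKrullDim_quotient p hp
      obtain ⟨hpp, u, hu⟩ := mem_associatedPrimes_quotient_iff.1 hp
      have hap : 𝔞 ≤ p := fun a ha => (hu a).2 (𝔞.mul_mem_right _ ha)
      have hyp : Ideal.span {y} ≤ p := (Ideal.span_singleton_le_iff_mem _).2 (h y hb)
      have := hle.trans (ringKrullDim_quotient_le_length ys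
        (fun z hz => hmem z (List.mem_cons_of_mem _ hz))
        (hrad.trans (Ideal.radical_mono (by
          rw [Ideal.ofList_cons]
          exact sup_le (hap.trans le_sup_left) (sup_le (hyp.trans le_sup_left) le_sup_right)))))
      have h' : (ys.length + 1 : ℕ) ≤ ys.length := by exact_mod_cast this
      omega
    intro i hi
    cases i with
    | zero => simpa using hy
    | succ i =>
      have := ih (𝔞 ⊔ Ideal.span {y}) (hreg.of_regularMod (hmem y (by simp)) hy)
        (fun z hz => hmem z (List.mem_cons_of_mem _ hz))
        (by rwa [Ideal.ofList_cons, ← sup_assoc] at hrad) i (by simpa using hi)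
      simpa [Ideal.ofList_cons, sup_assoc] using this

end Local

theorem hasRegSeq_of_isRegularMod {B : Type*} [CommRing B] [IsLocalRing B] :
    ∀ (ys : List B) (𝔞 : Ideal B) (n : ℕ), n ≤ ys.length →
    (∀ y ∈ ys, y ∈ maximalIdeal B) →
    (∀ i (h : i < ys.length), IsRegularMod (𝔞 ⊔ Ideal.ofList (ys.take i)) ys[i]) →
    HasRegSeq n 𝔞 := by
  intro ys
  induction ys with
  | nil => intro 𝔞 n hn _ _; obtain rfl : n = 0 := by simpa using hn
           trivial
  | cons y ys ih =>
    intro 𝔞 n hn hmem hreg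
    cases n with
    | zero => trivial
    | succ n =>
      refine ⟨y, hmem y (by simp), (by have := hreg 0 (by simp); simp at this; exact this),
        ih _ n (by simpa using hn) (fun z hz => hmem z (List.mem_cons_of_mem _ hz)) fun i hi => ?_⟩
      have := hreg (i + 1) (by simpa using hi)
      simpa [Ideal.ofList_cons, sup_assoc] using this

theorem isWeaklyRegular_iff_isRegularMod {B : Type*} [CommRing B] (ys : List B) :
    RingTheory.Sequence.IsWeaklyRegular B ys ↔
      ∀ i (h : i < ys.length), IsRegularMod (Ideal.ofList (ys.take i)) ys[i] := by
  rw [RingTheory.Sequence.isWeaklyRegular_iff]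
  refine forall₂_congr fun i hi => ?_
  rw [isSMulRegular_iff_right_eq_zero_of_smul]
  constructor
  · intro h b hb
    have := h (Submodule.Quotient.mk b) (by
      rw [← Submodule.Quotient.mk_smul, Submodule.Quotient.mk_eq_zero]
      simpa using hb)
    rw [Submodule.Quotient.mk_eq_zero] at this
    simpa using this
  · intro h x hx
    obtain ⟨b, rfl⟩ := Submodule.Quotient.mk_surjective _ x
    rw [← Submodule.Quotient.mk_smul, Submodule.Quotient.mk_eq_zero] at hx
    rw [Submodule.Quotient.mk_eq_zero]
    simpa using h b (by simpa using hx)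

theorem hasRegSeq_of_le_localDepth {B : Type*} [CommRing B] [IsLocalRing B] {n : ℕ}
    (h : (n : ℕ∞) ≤ localDepth B) : HasRegSeq n (⊥ : Ideal B) := by
  cases n with
  | zero => trivial
  | succ n =>
    -- The supremum need not be attained, but it exceeds n strictly, so some regular sequence has
    -- length at least n + 1.
    obtain ⟨rs, hrs⟩ := lt_iSup_iff.1 (lt_of_lt_of_le
      (show (n : ℕ∞) < ((n + 1 : ℕ) : ℕ∞) by exact_mod_cast n.lt_succ_self) h)
    obtain ⟨hreg, hrs⟩ := lt_iSup_iff.1 hrs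
    obtain ⟨hmem, hlt⟩ := lt_iSup_iff.1 hrs
    refine hasRegSeq_of_isRegularMod rs ⊥ (n + 1) (by exact_mod_cast hlt) hmem ?_
    simpa using (isWeaklyRegular_iff_isRegularMod rs).1 hreg.toIsWeaklyRegular

/-! ### Ideals generated by forms of one degree -/

section Graded

variable {k R : Type*} [Field k] [CommRing R] [Algebra k R]
  {𝒜 : ℕ → Submodule k R} [GradedAlgebra 𝒜]

theorem IsStandardGraded.isNoetherianRing (hR : IsStandardGraded 𝒜) : IsNoetherianRing R := by
  obtain ⟨s, hs⟩ := hR.degree_one_fg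
  have : Algebra.FiniteType k R := ⟨⟨s, by
    rw [← hR.adjoin_degree_one, ← hs, Algebra.adjoin_span]⟩⟩
  exact Algebra.FiniteType.isNoetherianRing k R

theorem GradedAlgebra.proj_of_mem {e : ℕ} {u : R} (hu : u ∈ 𝒜 e) : GradedAlgebra.proj 𝒜 e u = u := by
  rw [GradedAlgebra.proj_apply, DirectSum.decompose_of_mem_same 𝒜 hu]

theorem IsStandardGraded.exists_proj_zero (hR : IsStandardGraded 𝒜) (r : R) :
    ∃ c : k, GradedAlgebra.proj 𝒜 0 r = algebraMap k R c := by
  obtain ⟨c, hc⟩ := hR.degree_zero (GradedAlgebra.proj 𝒜 0 r) (by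
    rw [GradedAlgebra.proj_apply]; exact SetLike.coe_mem _)
  exact ⟨c, hc.symm⟩

theorem GradedAlgebra.proj_mul_of_mem {e : ℕ} (r : R) {u : R} (hu : u ∈ 𝒜 e) :
    GradedAlgebra.proj 𝒜 e (r * u) = GradedAlgebra.proj 𝒜 0 r * u := by
  have := DirectSum.coe_decompose_mul_add_of_right_mem 𝒜 (i := 0) (a := r) hu
  rw [zero_add] at this
  simpa [GradedAlgebra.proj_apply] using this

/-- An ideal generated in degree e has no components below e, so only the constant term of r reaches
degree e. -/
theorem GradedAlgebra.proj_mul_of_mem_span {e : ℕ} {U : Set R} (hU : U ⊆ 𝒜 e) {x : R}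
    (hx : x ∈ Ideal.span U) : ∀ r, GradedAlgebra.proj 𝒜 e (r * x) =
      GradedAlgebra.proj 𝒜 0 r * GradedAlgebra.proj 𝒜 e x := by
  refine Submodule.span_induction (p := fun x _ => ∀ r, GradedAlgebra.proj 𝒜 e (r * x) =
      GradedAlgebra.proj 𝒜 0 r * GradedAlgebra.proj 𝒜 e x) ?_ ?_ ?_ ?_ hx
  · intro u hu r
    rw [GradedAlgebra.proj_mul_of_mem r (hU hu), GradedAlgebra.proj_of_mem (hU hu)]
  · simp
  · intro x y _ _ hx hy r
    rw [mul_add, map_add, hx, hy, map_add, mul_add]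
  · intro a x _ hx r
    rw [smul_eq_mul, ← mul_assoc, hx, hx, ← mul_assoc]
    congr 1
    exact map_mul (GradedRing.projZeroRingHom 𝒜) r a

theorem IsStandardGraded.proj_mem_of_mem_span (hR : IsStandardGraded 𝒜) {e : ℕ}
    {U : Submodule k R} (hU : U ≤ 𝒜 e) {x : R} (hx : x ∈ Ideal.span (U : Set R)) :
    GradedAlgebra.proj 𝒜 e x ∈ U := by
  induction hx using Submodule.span_induction with
  | mem u hu => rwa [GradedAlgebra.proj_of_mem (hU hu)]
  | zero => simp
  | add x y _ _ hx hy => rw [map_add]; exact U.add_mem hx hy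
  | smul a x hx' hx =>
    rw [smul_eq_mul, GradedAlgebra.proj_mul_of_mem_span hU hx']
    obtain ⟨c, hc⟩ := hR.exists_proj_zero a
    rw [hc, ← Algebra.smul_def]
    exact U.smul_mem _ hx

theorem Ideal.span_coe_span_eq (s : Set R) :
    Ideal.span ((Submodule.span k s : Submodule k R) : Set R) = Ideal.span s :=
  Submodule.span_span_of_tower k R s

/-- Graded Nakayama: a k-basis of U generates the ideal, and no generating set, homogeneous or not,
can be smaller. -/
theorem IsStandardGraded.minGens_span (hR : IsStandardGraded 𝒜) {e : ℕ}
    {U : Submodule k R} (hU : U ≤ 𝒜 e) (hfg : U.FG) :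
    minGens (Ideal.span (U : Set R)) = Module.finrank k U := by
  have := hR.isNoetherianRing
  have hfin : Module.Finite k U := Module.Finite.iff_fg.2 hfg
  refine le_antisymm ?_ ?_
  · let b := Module.finBasis k U
    have hb : Submodule.span k (Set.range fun i => (b i : R)) = U := by
      have := congrArg (Submodule.map U.subtype) b.span_eq
      rwa [Submodule.map_span, ← Set.range_comp, Submodule.map_top, Submodule.range_subtype] at this
    have hs : Ideal.span (U : Set R) = Ideal.span (Set.range fun i => (b i : R)) := by
      conv_lhs => rw [← hb]
      exact Ideal.span_coe_span_eq _
    rw [minGens, hs]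
    refine (Submodule.spanFinrank_span_le_ncard_of_finite (Set.finite_range _)).trans ?_
    rw [← Set.image_univ]
    refine (Set.ncard_image_le Set.finite_univ).trans ?_
    simp
  · have hI : (Ideal.span (U : Set R)).FG := IsNoetherian.noetherian _
    set I := Ideal.span (U : Set R) with hIdef
    set G := Submodule.generators I
    have hG : Ideal.span G = I := Submodule.span_generators I
    have hGfin : G.Finite := Submodule.FG.finite_generators hI
    -- Multiplying a generator by a ring element only scales its degree-e component by a constant,
    -- so these components already span U over k.
    have hle : U ≤ Submodule.span k (GradedAlgebra.proj 𝒜 e '' G) := by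
      have key : ∀ x ∈ Ideal.span G, GradedAlgebra.proj 𝒜 e x ∈
          Submodule.span k (GradedAlgebra.proj 𝒜 e '' G) := by
        intro x hx
        induction hx using Submodule.span_induction with
        | mem u hu => exact Submodule.subset_span ⟨u, hu, rfl⟩
        | zero => simp
        | add x y _ _ hx hy => rw [map_add]; exact add_mem hx hy
        | smul a x hx' hx =>
          rw [smul_eq_mul, GradedAlgebra.proj_mul_of_mem_span hU (by rw [← hIdef, ← hG]; exact hx')]
          obtain ⟨c, hc⟩ := hR.exists_proj_zero a
          rw [hc, ← Algebra.smul_def]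
          exact Submodule.smul_mem _ _ hx
      intro u hu
      rw [← GradedAlgebra.proj_of_mem (hU hu)]
      exact key u (by rw [hG]; exact Ideal.subset_span hu)
    have hfin' := hGfin.image (GradedAlgebra.proj 𝒜 e)
    have : Module.Finite k (Submodule.span k (GradedAlgebra.proj 𝒜 e '' G)) :=
      Module.Finite.span_of_finite k hfin'
    calc Module.finrank k U ≤ Module.finrank k (Submodule.span k (GradedAlgebra.proj 𝒜 e '' G)) :=
          Submodule.finrank_mono hle
      _ ≤ (GradedAlgebra.proj 𝒜 e '' G).ncard := by
          have := hfin'.fintype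
          rw [Set.ncard_eq_toFinset_card']
          exact finrank_span_le_card _
      _ ≤ G.ncard := Set.ncard_image_le hGfin
      _ = minGens I := Submodule.FG.generators_ncard hI

theorem IsStandardGraded.degPart_fg (hR : IsStandardGraded 𝒜) (I : Ideal R) (d : ℕ) :
    (degPart 𝒜 I d).FG := by
  have := hR.isNoetherianRing
  obtain ⟨t, ht, hspan⟩ := (Submodule.fg_span_iff_fg_span_finset_subset
    (R := R) (degPart 𝒜 I d : Set R)).1 (IsNoetherian.noetherian _)
  have hle : Submodule.span k (t : Set R) ≤ 𝒜 d :=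
    Submodule.span_le.2 fun x hx => (ht hx).2
  refine ⟨t, le_antisymm (Submodule.span_le.2 ht) fun x hx => ?_⟩
  rw [← GradedAlgebra.proj_of_mem (𝒜 := 𝒜) hx.2]
  refine hR.proj_mem_of_mem_span hle ?_
  rw [Ideal.span_coe_span_eq]
  have : x ∈ Submodule.span R (degPart 𝒜 I d : Set R) := Submodule.subset_span hx
  rw [hspan] at this
  exact this

end Graded

/-! ### Dimension count for a product of spaces of forms -/

section LinearAlgebra

variable {k R : Type*} [Field k] [CommRing R] [Algebra k R]

theorem linearIndependent_of_notMem_span {M : Type*} [AddCommGroup M] [Module k M] :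
    ∀ {l : ℕ} {f : Fin l → M}, (∀ i, f i ∉ Submodule.span k (f '' Set.Iio i)) →
    LinearIndependent k f := by
  intro l
  induction l with
  | zero => intro f _; exact linearIndependent_empty_type
  | succ l ih =>
    intro f hf
    rw [linearIndependent_finSucc']
    refine ⟨ih fun i hi => hf i.castSucc (Submodule.span_mono ?_ hi), fun h =>
      hf (Fin.last l) (Submodule.span_mono ?_ h)⟩
    · rintro _ ⟨j, hj, rfl⟩
      exact ⟨j.castSucc, by simpa using hj, rfl⟩
    · rintro _ ⟨j, rfl⟩
      exact ⟨j.castSucc, j.castSucc_lt_last, rfl⟩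

/-- The i-th form (counted from zero) contributes dim V − i new dimensions, the defect i being
exactly the span of its predecessors. The defects add up to the binomial coefficient, which stays on
the left to avoid subtraction. -/
theorem finrank_mul_span_add_choose {V : Submodule k R} (hV : V.FG) :
    ∀ {l : ℕ} {f : Fin l → R}, (∀ j, f j ∈ V) → LinearIndependent k f →
    (∀ i, ∀ g ∈ V, g * f i ∈ V * Submodule.span k (f '' Set.Iio i) →
      g ∈ Submodule.span k (f '' Set.Iio i)) →
    Module.finrank k ↥(V * Submodule.span k (Set.range f)) + l.choose 2 =
      l * Module.finrank k V := by
  intro l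
  induction l with
  | zero =>
    intro f _ _ _
    rw [Set.range_eq_empty f, Submodule.span_empty, Submodule.mul_bot, finrank_bot]
    simp
  | succ l ih =>
    intro f hfV hli hcolon
    have hVfin : Module.Finite k V := Module.Finite.iff_fg.2 hV
    set f' : Fin l → R := Fin.init f with hf'
    have himg : ∀ i : Fin l, f '' Set.Iio i.castSucc = f' '' Set.Iio i := by
      intro i
      ext x
      constructor
      · rintro ⟨j, hj, rfl⟩
        have hj' : j.1 < i.1 := hj
        exact ⟨⟨j.1, by omega⟩, hj', rfl⟩
      · rintro ⟨j, hj, rfl⟩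
        exact ⟨j.castSucc, by simpa using hj, rfl⟩
    have hlast : f '' Set.Iio (Fin.last l) = Set.range f' := by
      ext x
      constructor
      · rintro ⟨j, hj, rfl⟩
        have hj' : j.1 < l := hj
        exact ⟨⟨j.1, hj'⟩, rfl⟩
      · rintro ⟨j, rfl⟩
        exact ⟨j.castSucc, j.castSucc_lt_last, rfl⟩
    obtain ⟨hli', -⟩ := linearIndependent_finSucc'.1 hli
    have hIH := ih (f := f') (fun j => hfV _) hli' fun i g hg h => by
      rw [← himg] at h ⊢
      exact hcolon _ g hg h
    have hc := hcolon (Fin.last l)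
    rw [hlast] at hc
    set W := Submodule.span k (Set.range f') with hW
    have hWV : W ≤ V := Submodule.span_le.2 (by rintro _ ⟨j, rfl⟩; exact hfV _)
    have hrange : Submodule.span k (Set.range f) = W ⊔ Submodule.span k {f (Fin.last l)} := by
      rw [hW, ← Submodule.span_union]
      congr 1
      ext x
      constructor
      · rintro ⟨j, rfl⟩
        rcases Fin.eq_castSucc_or_eq_last j with ⟨j, rfl⟩ | rfl
        · exact Or.inl ⟨j, rfl⟩
        · exact Or.inr rfl
      · rintro (⟨j, rfl⟩ | rfl)
        · exact ⟨_, rfl⟩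
        · exact ⟨_, rfl⟩
    have hfW : (W).FG := Submodule.fg_span (Set.finite_range _)
    have hP : (V * W).FG := hV.mul hfW
    set Q := V * Submodule.span k (Set.range f) with hQ
    have hQfg : Q.FG := hV.mul (Submodule.fg_span (Set.finite_range _))
    have hPQ : V * W ≤ Q := by
      rw [hQ, hrange]; exact mul_le_mul_right le_sup_left _
    have hQfin : Module.Finite k Q := Module.Finite.iff_fg.2 hQfg
    have hPfin : Module.Finite k ↥(V * W) := Module.Finite.iff_fg.2 hP
    -- The kernel of multiplication by the last form modulo V·W contains W by commutativity and is
    -- contained in it by the colon hypothesis. The range is Q/(V·W).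
    let L : V →ₗ[k] R ⧸ (V * W) :=
      (V * W).mkQ ∘ₗ LinearMap.mulRight k (f (Fin.last l)) ∘ₗ V.subtype
    have hker : LinearMap.ker L = W.comap V.subtype := by
      ext g
      simp only [LinearMap.mem_ker, L, LinearMap.comp_apply, Submodule.mkQ_apply,
        Submodule.Quotient.mk_eq_zero, LinearMap.mulRight_apply, Submodule.mem_comap,
        Submodule.subtype_apply]
      exact ⟨fun h => hc g g.2 h, fun h =>
        mul_comm (f (Fin.last l)) g ▸ Submodule.mul_mem_mul (hfV _) h⟩
    have hrangeL : LinearMap.range L = Q.map (V * W).mkQ := by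
      have hmul : V * Submodule.span k {f (Fin.last l)} =
          V.map (LinearMap.mulRight k (f (Fin.last l))) := by
        ext x
        rw [mul_comm, Submodule.mem_span_singleton_mul]
        simp only [Submodule.mem_map, LinearMap.mulRight_apply, mul_comm]
      rw [hQ, hrange, Submodule.mul_sup, Submodule.map_sup, hmul]
      rw [show Submodule.map (V * W).mkQ (V * W) = ⊥ by
        rw [← le_bot_iff, Submodule.map_le_iff_le_comap]
        intro x hx
        simpa using hx, bot_sup_eq]
      rw [LinearMap.range_comp, LinearMap.range_comp, Submodule.range_subtype]
    have h1 := LinearMap.finrank_range_add_finrank_ker L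
    have h2 : Module.finrank k (LinearMap.ker L) = l := by
      rw [hker, (Submodule.comapSubtypeEquivOfLe hWV).finrank_eq, hW, finrank_span_eq_card hli',
        Fintype.card_fin]
    have h3 : Module.finrank k (LinearMap.range L) + Module.finrank k ↥(V * W) =
        Module.finrank k Q := by
      rw [hrangeL]
      have h := LinearMap.finrank_range_add_finrank_ker ((V * W).mkQ ∘ₗ Q.subtype)
      rw [LinearMap.range_comp, Submodule.range_subtype, LinearMap.ker_comp, Submodule.ker_mkQ,
        (Submodule.comapSubtypeEquivOfLe hPQ).finrank_eq] at h
      exact h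
    rw [h2] at h1
    have hch : (l + 1).choose 2 = l + l.choose 2 := by
      rw [Nat.choose_succ_succ' l 1, Nat.choose_one_right]
    rw [hch, add_mul, one_mul]
    omega

end LinearAlgebra

/-! ### From the colon condition to adjusted forms -/

section Adjusted

variable {k R : Type*} [Field k] [CommRing R] [Algebra k R]
  {𝒜 : ℕ → Submodule k R} [GradedAlgebra 𝒜]

theorem IsStandardGraded.isAdjusted (hR : IsStandardGraded 𝒜) {I : Ideal R} {d : ℕ}
    (hd : IsEquigenerated 𝒜 I d) {l : ℕ} {f : Fin l → R} (hf : ∀ j, f j ∈ degPart 𝒜 I d)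
    (hli : LinearIndependent k f)
    (hcolon : ∀ i, ∀ g ∈ degPart 𝒜 I d,
      g * f i ∈ degPart 𝒜 I d * Submodule.span k (f '' Set.Iio i) →
      g ∈ Submodule.span k (f '' Set.Iio i)) :
    IsAdjusted 𝒜 I d f := by
  refine ⟨hf, hli, ?_⟩
  set V := degPart 𝒜 I d with hV
  have hVfg : V.FG := hR.degPart_fg I d
  have hVd : V ≤ 𝒜 d := inf_le_right
  have hWd : Submodule.span k (Set.range f) ≤ 𝒜 d :=
    Submodule.span_le.2 (by rintro _ ⟨j, rfl⟩; exact (hf j).2)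
  have h1 : minGens I = Module.finrank k V := by
    rw [← hR.minGens_span hVd hVfg]
    exact congrArg _ hd.symm
  have h2 : I * Ideal.span (Set.range f) =
      Ideal.span ((V * Submodule.span k (Set.range f) : Submodule k R) : Set R) := by
    conv_rhs => rw [Submodule.mul_eq_span_mul_set, Ideal.span_coe_span_eq, ← Ideal.span_mul_span',
      Ideal.span_coe_span_eq]
    exact congrArg (· * _) hd.symm
  have hle : V * Submodule.span k (Set.range f) ≤ 𝒜 (d + d) :=
    Submodule.mul_le.2 fun v hv w hw => SetLike.mul_mem_graded (hVd hv) (hWd hw)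
  have h3 := finrank_mul_span_add_choose hVfg hf hli hcolon
  rw [h2, hR.minGens_span hle (hVfg.mul (Submodule.fg_span (Set.finite_range _))), h1]
  have h4 : ((Module.finrank k ↥(V * Submodule.span k (Set.range f)) : ℕ) : ℤ) + (l.choose 2 : ℕ) =
      (l : ℤ) * (Module.finrank k V : ℕ) := by exact_mod_cast h3
  linarith

end Adjusted

theorem Ideal.ofList_take_ofFn {A : Type*} [CommRing A] {l : ℕ} (f : Fin l → A) (i : Fin l) :
    Ideal.ofList ((List.ofFn f).take i) = Ideal.span (f '' Set.Iio i) := by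
  rw [Ideal.ofList]
  congr 1
  ext x
  simp only [Set.mem_ofPred_eq, List.mem_take_iff_getElem, List.getElem_ofFn, Set.mem_image,
    Set.mem_Iio, List.length_ofFn]
  constructor
  · rintro ⟨j, hj, rfl⟩
    exact ⟨⟨j, by omega⟩, by rw [Fin.lt_def]; simp only; omega, rfl⟩
  · rintro ⟨j, hj, rfl⟩
    exact ⟨j, by rw [Fin.lt_def] at hj; omega, rfl⟩

/-! ### Regular sequences in the algebra generated by the forms -/

section FormAlgebra

variable {k R : Type*} [Field k] [CommRing R] [Algebra k R]
  {𝒜 : ℕ → Submodule k R} [GradedAlgebra 𝒜]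

theorem IsStandardGraded.isAdjusted_of_isRegular (hR : IsStandardGraded 𝒜) {I : Ideal R} {d : ℕ}
    (hd : IsEquigenerated 𝒜 I d) {l : ℕ} {f : Fin l → formAlgebra 𝒜 I d}
    (hf : ∀ j, (f j : R) ∈ degPart 𝒜 I d)
    (hreg : RingTheory.Sequence.IsRegular (formAlgebra 𝒜 I d) (List.ofFn f))
    {i : ℕ} (hil : i ≤ l) :
    IsAdjusted 𝒜 I d (fun j : Fin i => (f (Fin.castLE hil j) : R)) := by
  set f' : Fin i → R := fun j => (f (Fin.castLE hil j) : R) with hf'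
  have hreg' : ∀ j : Fin l, IsRegularMod (Ideal.span (f '' Set.Iio j)) (f j) := by
    intro j
    have := (isWeaklyRegular_iff_isRegularMod _).1 hreg.toIsWeaklyRegular j (by simp)
    rwa [Ideal.ofList_take_ofFn, List.getElem_ofFn] at this
  have himg : ∀ j : Fin i, f' '' Set.Iio j =
      (formAlgebra 𝒜 I d).val '' (f '' Set.Iio (Fin.castLE hil j)) := by
    intro j
    ext x
    simp only [Set.mem_image, Set.mem_Iio, exists_exists_and_eq_and]
    constructor
    · rintro ⟨a, ha, rfl⟩
      exact ⟨Fin.castLE hil a, ha, rfl⟩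
    · rintro ⟨a, ha, rfl⟩
      rw [Fin.lt_def] at ha
      simp only [Fin.val_castLE] at ha
      exact ⟨⟨a, by omega⟩, ha, rfl⟩
  have hmem : ∀ (j : Fin i) (x : formAlgebra 𝒜 I d), (x : R) ∈ 𝒜 d →
      x ∈ Ideal.span (f '' Set.Iio (Fin.castLE hil j)) →
      (x : R) ∈ Submodule.span k (f' '' Set.Iio j) := by
    intro j x hx hxs
    have h1 : (x : R) ∈ Ideal.span
        ((Submodule.span k (f' '' Set.Iio j) : Submodule k R) : Set R) := by
      rw [Ideal.span_coe_span_eq, himg, ← Ideal.map_span]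
      exact Ideal.mem_map_of_mem _ hxs
    rw [← GradedAlgebra.proj_of_mem (𝒜 := 𝒜) hx]
    refine hR.proj_mem_of_mem_span (Submodule.span_le.2 ?_) h1
    rintro _ ⟨a, -, rfl⟩
    exact (hf _).2
  -- Since I_d lies in k[I_d], these products belong to the ideal of the earlier forms inside the
  -- subalgebra, where regularity is available.
  have hlift : ∀ (j : Fin i), degPart 𝒜 I d * Submodule.span k (f' '' Set.Iio j) ≤
      ((Ideal.span (f '' Set.Iio (Fin.castLE hil j))).restrictScalars k).map
        (formAlgebra 𝒜 I d).val.toLinearMap := by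
    intro j
    rw [← Submodule.span_eq (degPart 𝒜 I d), Submodule.span_mul_span, Submodule.span_le]
    rintro _ ⟨v, hv, _, ⟨a, ha, rfl⟩, rfl⟩
    have hv' : v ∈ formAlgebra 𝒜 I d := Algebra.subset_adjoin hv
    refine ⟨⟨v, hv'⟩ * f (Fin.castLE hil a), Ideal.mul_mem_left _ _
      (Ideal.subset_span ⟨_, ?_, rfl⟩), rfl⟩
    exact ha
  have hcolon : ∀ (j : Fin i) (g : formAlgebra 𝒜 I d),
      (g : R) * f' j ∈ degPart 𝒜 I d * Submodule.span k (f' '' Set.Iio j) →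
      g ∈ Ideal.span (f '' Set.Iio (Fin.castLE hil j)) := by
    intro j g hg
    obtain ⟨x, hx, hxg⟩ := hlift j hg
    refine hreg' _ g ?_
    have : f (Fin.castLE hil j) * g = x := Subtype.ext ((mul_comm _ _).trans hxg.symm)
    rw [this]
    exact hx
  refine hR.isAdjusted hd (fun j => hf _) (linearIndependent_of_notMem_span fun j hj => ?_)
    fun j g hg h => hmem j ⟨g, Algebra.subset_adjoin hg⟩ hg.2 (hcolon j _ h)
  -- Linear independence: a form in the span of its predecessors is zero modulo them, yet regular,
  -- so their ideal would be the whole ring. This contradicts properness of the regular sequence.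
  have h1 : (1 : formAlgebra 𝒜 I d) ∈ Ideal.span (f '' Set.Iio (Fin.castLE hil j)) := by
    refine hreg' _ 1 ?_
    rw [mul_one]
    have h2 : Submodule.span k (f' '' Set.Iio j) ≤
      ((Ideal.span (f '' Set.Iio (Fin.castLE hil j))).restrictScalars k).map
        (formAlgebra 𝒜 I d).val.toLinearMap := by
      rw [Submodule.span_le]
      rintro _ ⟨a, ha, rfl⟩
      exact ⟨f (Fin.castLE hil a), Ideal.subset_span ⟨_, ha, rfl⟩, rfl⟩
    obtain ⟨x, hx, hxg⟩ := h2 hj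
    have : f (Fin.castLE hil j) = x := Subtype.ext hxg.symm
    rw [this]
    exact hx
  refine hreg.top_ne_smul (Eq.symm ?_)
  rw [smul_eq_mul, Ideal.mul_top, Ideal.eq_top_iff_one]
  refine Ideal.span_mono ?_ h1
  rintro _ ⟨a, -, rfl⟩
  simp

end FormAlgebra

/-! ### Eliminating a generator from a reduction -/

section Reduction

variable {R : Type*} [CommRing R]

theorem IsReduction.pow_mul_pow {I J : Ideal R} {n : ℕ} (h : J * I ^ n = I ^ (n + 1)) (m : ℕ) :
    J ^ m * I ^ n = I ^ (n + m) := by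
  induction m with
  | zero => simp
  | succ m ih =>
    rw [pow_succ', mul_assoc, ih, pow_add, ← mul_assoc, h, ← pow_add]
    congr 1
    ring

theorem Ideal.pow_succ_le_mul_pow_sup {K J : Ideal R} {x : R} (hx : x ∈ J)
    (hJ : J ≤ K ⊔ Ideal.span {x}) (m : ℕ) :
    J ^ (m + 1) ≤ K * J ^ m ⊔ Ideal.span {x ^ (m + 1)} := by
  induction m with
  | zero => simpa using hJ
  | succ m ih =>
    calc J ^ (m + 1 + 1) = J ^ (m + 1) * J := pow_succ _ _
      _ ≤ (K * J ^ m ⊔ Ideal.span {x ^ (m + 1)}) * J := Ideal.mul_mono_left ih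
      _ = K * J ^ (m + 1) ⊔ Ideal.span {x ^ (m + 1)} * J := by
          rw [Ideal.sup_mul, mul_assoc, ← pow_succ]
      _ ≤ K * J ^ (m + 1) ⊔ Ideal.span {x ^ (m + 1 + 1)} := by
          refine sup_le le_sup_left ?_
          refine (Ideal.mul_mono_right hJ).trans ?_
          rw [Ideal.mul_sup, Ideal.span_singleton_mul_span_singleton, ← pow_succ]
          refine sup_le_sup_right ?_ _
          rw [mul_comm]
          refine Ideal.mul_mono_right ?_
          rw [Ideal.span_singleton_le_iff_mem]
          exact Ideal.pow_mem_pow hx _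

/-- As J = K + (x), the power J^(m+1) is generated by x^(m+1) modulo K·J^m. The hypothesis thus
makes K a reduction of J, and being a reduction is transitive. -/
theorem IsReduction.of_pow_mem {I J K : Ideal R} {x : R} (h : IsReduction J I) (hKJ : K ≤ J)
    (hx : x ∈ J) (hJ : J ≤ K ⊔ Ideal.span {x}) {m : ℕ} (hm : x ^ (m + 1) ∈ K * J ^ m) :
    IsReduction K I := by
  obtain ⟨hJI, n, hn⟩ := h
  refine ⟨hKJ.trans hJI, n + m, ?_⟩
  refine le_antisymm ?_ ?_
  · rw [pow_succ']
    exact Ideal.mul_mono_left (hKJ.trans hJI)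
  · have h1 : J ^ (m + 1) ≤ K * J ^ m := (Ideal.pow_succ_le_mul_pow_sup hx hJ m).trans
      (sup_le le_rfl ((Ideal.span_singleton_le_iff_mem _).2 hm))
    calc I ^ (n + m + 1) = J ^ (m + 1) * I ^ n := (IsReduction.pow_mul_pow hn (m + 1)).symm
      _ ≤ K * J ^ m * I ^ n := Ideal.mul_mono_left h1
      _ = K * I ^ (n + m) := by rw [mul_assoc, IsReduction.pow_mul_pow hn]

variable {k : Type*} [Field k] [Algebra k R]

/-- Replacing each c₀f_i by c_i x changes a monomial of degree m + 1 by terms with one factor in K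
and m factors in J. Tracking the error in K·J^m, not merely in K, is what `IsReduction.of_pow_mem`
requires. -/
theorem smul_multiset_prod_sub_mem {ι : Type*} {K J : Ideal R} {f : ι → R} (hf : ∀ i, f i ∈ J)
    {x : R} (hx : x ∈ J) {c : ι → k} {c₀ : k} (h : ∀ i, c₀ • f i - c i • x ∈ K)
    (s : Multiset ι) : ∀ m, s.card = m + 1 →
    c₀ ^ (m + 1) • (s.map f).prod - (s.map c).prod • x ^ (m + 1) ∈ K * J ^ m := by
  induction s using Multiset.induction_on with
  | empty => intro m hm; simp at hm
  | cons i s ih =>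
    intro m hm
    have hs : s.card = m := by simpa using hm
    rw [Multiset.map_cons, Multiset.prod_cons, Multiset.map_cons, Multiset.prod_cons]
    have hid : c₀ ^ (m + 1) • (f i * (s.map f).prod) - (c i * (s.map c).prod) • x ^ (m + 1) =
        (c₀ • f i) * (c₀ ^ m • (s.map f).prod - (s.map c).prod • x ^ m) +
          (c₀ • f i - c i • x) * ((s.map c).prod • x ^ m) := by
      simp only [Algebra.smul_def, map_mul, map_pow]
      ring
    rw [hid]
    refine Ideal.add_mem _ ?_ (Ideal.mul_mem_mul (h i) ?_)
    · cases m with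
      | zero =>
        obtain rfl := Multiset.card_eq_zero.1 hs
        simp
      | succ m =>
        rw [pow_succ' J, mul_left_comm]
        refine Ideal.mul_mem_mul ?_ (ih m hs)
        rw [Algebra.smul_def]
        exact J.mul_mem_left _ (hf i)
    · rw [Algebra.smul_def]
      exact Ideal.mul_mem_left _ _ (Ideal.pow_mem_pow hx m)

theorem smul_aeval_sub_mem {l : ℕ} {K J : Ideal R} {f : Fin l → R} (hf : ∀ i, f i ∈ J)
    {x : R} (hx : x ∈ J) {c : Fin l → k} {c₀ : k} (h : ∀ i, c₀ • f i - c i • x ∈ K)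
    {p : MvPolynomial (Fin l) k} {m : ℕ} (hp : p.IsHomogeneous (m + 1)) :
    c₀ ^ (m + 1) • MvPolynomial.aeval f p - MvPolynomial.eval c p • x ^ (m + 1) ∈ K * J ^ m := by
  have h1 : c₀ ^ (m + 1) • MvPolynomial.aeval f p - MvPolynomial.eval c p • x ^ (m + 1) =
      ∑ a ∈ p.support, algebraMap k R (p.coeff a) *
        (c₀ ^ (m + 1) • ((Finsupp.toMultiset a).map f).prod -
          ((Finsupp.toMultiset a).map c).prod • x ^ (m + 1)) := by
    rw [MvPolynomial.aeval_def, MvPolynomial.eval₂_eq, MvPolynomial.eval_eq, Finset.smul_sum,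
      Finset.sum_smul, ← Finset.sum_sub_distrib]
    refine Finset.sum_congr rfl fun a _ => ?_
    rw [Finset.prod_multiset_map_count, Finset.prod_multiset_map_count,
      Finsupp.toFinset_toMultiset]
    simp only [Finsupp.count_toMultiset, Algebra.smul_def, map_mul, map_pow, map_prod]
    ring
  rw [h1]
  refine Ideal.sum_mem _ fun a ha => Ideal.mul_mem_left _ _
    (smul_multiset_prod_sub_mem hf hx h _ m ?_)
  rw [Finsupp.card_toMultiset]
  exact (hp.degree_eq_sum_deg_support ha).symm

end Reduction

/-! ### Algebraic independence of the generators of a minimal reduction -/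

section MinimalReduction

variable {k R : Type*} [Field k] [CommRing R] [Algebra k R]
  {𝒜 : ℕ → Submodule k R} [GradedAlgebra 𝒜]

/-- A nonzero relation is nonzero at some point c, since k is infinite. Modulo the forms c_{j₀}f_i −
c_i f_{j₀}, evaluating the relation leaves a nonzero multiple of a power of f_{j₀}. These l − 1
forms therefore already generate a homogeneous reduction inside J, which contradicts minimality
together with l = μ(J). -/
theorem IsMinimalReduction.eq_zero_of_aeval_eq_zero [Infinite k] [Nontrivial R] {I : Ideal R}
    {d l : ℕ} {f : Fin l → R} (hf : ∀ j, f j ∈ 𝒜 d)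
    (hJ : IsMinimalReduction 𝒜 (Ideal.span (Set.range f)) I)
    (hl : l = minGens (Ideal.span (Set.range f)))
    {p : MvPolynomial (Fin l) k} {N : ℕ} (hp : p.IsHomogeneous N)
    (h0 : MvPolynomial.aeval f p = 0) : p = 0 := by
  rcases isEmpty_or_nonempty (Fin l) with hemp | ⟨⟨j₀⟩⟩
  · rw [MvPolynomial.eq_C_of_isEmpty p, MvPolynomial.aeval_C] at h0
    rw [MvPolynomial.eq_C_of_isEmpty p, (map_eq_zero _).1 h0, map_zero]
  by_contra hne
  -- The extra factor forces c_{j₀} ≠ 0 at any point where q does not vanish, and it makes the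
  -- degree positive.
  set q := p * MvPolynomial.X j₀ with hq
  have hqne : q ≠ 0 := mul_ne_zero hne (MvPolynomial.X_ne_zero _)
  have hqhom : q.IsHomogeneous (N + 1) := hp.mul (MvPolynomial.isHomogeneous_X _ _)
  have hq0 : MvPolynomial.aeval f q = 0 := by rw [hq, map_mul, h0, zero_mul]
  obtain ⟨c, hc⟩ : ∃ c, MvPolynomial.eval c q ≠ 0 := by
    by_contra! hcon
    exact hqne (MvPolynomial.funext fun c => by rw [hcon c, map_zero])
  have hcj : c j₀ ≠ 0 := fun h => hc (by rw [hq, map_mul, MvPolynomial.eval_X, h, mul_zero])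
  set J := Ideal.span (Set.range f) with hJdef
  have hfJ : ∀ i, f i ∈ J := fun i => Ideal.subset_span ⟨i, rfl⟩
  let g : Fin l → R := fun i => c j₀ • f i - c i • f j₀
  let K : Ideal R := Ideal.span (g '' {j₀}ᶜ)
  have hgK : ∀ i, c j₀ • f i - c i • f j₀ ∈ K := by
    intro i
    by_cases hi : i = j₀
    · rw [hi, sub_self]; exact K.zero_mem
    · exact Ideal.subset_span ⟨i, hi, rfl⟩
  have hsmul : ∀ (L : Ideal R) (a : k) {r : R}, r ∈ L → a • r ∈ L := fun L a r hr => by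
    rw [Algebra.smul_def]; exact L.mul_mem_left _ hr
  have hKJ : K ≤ J := by
    rw [Ideal.span_le]
    rintro _ ⟨i, -, rfl⟩
    exact J.sub_mem (hsmul _ _ (hfJ i)) (hsmul _ _ (hfJ j₀))
  have hJK : J ≤ K ⊔ Ideal.span {f j₀} := by
    rw [hJdef, Ideal.span_le]
    rintro _ ⟨i, rfl⟩
    have : f i = (c j₀)⁻¹ • (c j₀ • f i - c i • f j₀) + (c j₀)⁻¹ • c i • f j₀ := by
      rw [← smul_add, sub_add_cancel, inv_smul_smul₀ hcj]
    rw [this]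
    exact Submodule.add_mem_sup (hsmul _ _ (hgK i))
      (hsmul _ _ (hsmul _ _ (Ideal.mem_span_singleton_self _)))
  have hx : f j₀ ^ (N + 1) ∈ K * J ^ N := by
    have h1 := smul_aeval_sub_mem hfJ (hfJ j₀) hgK hqhom
    rw [hq0, smul_zero, zero_sub, neg_mem_iff] at h1
    have h2 := hsmul _ (MvPolynomial.eval c q)⁻¹ h1
    rwa [inv_smul_smul₀ hc] at h2
  have hKred : IsReduction K I := hJ.2.1.of_pow_mem hKJ (hfJ j₀) hJK hx
  have hKhom : K.IsHomogeneous 𝒜 := by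
    refine Ideal.homogeneous_span _ _ ?_
    rintro _ ⟨i, -, rfl⟩
    exact ⟨d, (𝒜 d).sub_mem ((𝒜 d).smul_mem _ (hf _)) ((𝒜 d).smul_mem _ (hf _))⟩
  have hKeq := hJ.2.2 K hKhom hKred hKJ
  have hle : minGens K ≤ l - 1 := by
    refine (Submodule.spanFinrank_span_le_ncard_of_finite (Set.toFinite _)).trans ?_
    refine (Set.ncard_image_le (Set.toFinite _)).trans ?_
    rw [Set.ncard_compl, Set.ncard_singleton, Nat.card_fin]
  rw [hKeq, ← hl] at hle
  have := j₀.2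
  omega

end MinimalReduction

/-! ### The Rees algebra and its special fiber -/

section SpecialFiber

variable {k R : Type*} [Field k] [CommRing R] [Algebra k R]
  {𝒜 : ℕ → Submodule k R} [GradedAlgebra 𝒜]

theorem mem_irrelevantIdeal_iff {r : R} :
    r ∈ irrelevantIdeal 𝒜 ↔ GradedAlgebra.proj 𝒜 0 r = 0 :=
  HomogeneousIdeal.mem_irrelevant_iff 𝒜 r

theorem IsStandardGraded.exists_sub_mem_irrelevantIdeal (hR : IsStandardGraded 𝒜) (r : R) :
    ∃ c : k, r - algebraMap k R c ∈ irrelevantIdeal 𝒜 := by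
  obtain ⟨c, hc⟩ := hR.exists_proj_zero r
  refine ⟨c, ?_⟩
  rw [mem_irrelevantIdeal_iff, map_sub, ← hc, sub_eq_zero]
  exact (GradedAlgebra.proj_of_mem (by
    rw [GradedAlgebra.proj_apply]; exact SetLike.coe_mem _)).symm

theorem IsStandardGraded.irrelevantIdeal_isMaximal (hR : IsStandardGraded 𝒜) :
    (irrelevantIdeal 𝒜).IsMaximal := by
  have := hR.nontrivial
  rw [Ideal.isMaximal_iff]
  refine ⟨fun h => ?_, fun J x hJ hx hxJ => ?_⟩
  · rw [mem_irrelevantIdeal_iff, GradedAlgebra.proj_of_mem SetLike.GradedOne.one_mem] at h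
    exact one_ne_zero h
  · obtain ⟨c, hc⟩ := hR.exists_sub_mem_irrelevantIdeal x
    have hc0 : c ≠ 0 := by
      rintro rfl
      rw [map_zero, sub_zero] at hc
      exact hx hc
    have h1 : algebraMap k R c ∈ J := by
      have := J.sub_mem hxJ (hJ hc)
      rwa [sub_sub_cancel] at this
    have h2 := J.mul_mem_left (algebraMap k R c⁻¹) h1
    rwa [← map_mul, inv_mul_cancel₀ hc0, map_one] at h2

variable {I : Ideal R}

/-- The element `a tⁱ` of the Rees algebra. -/
noncomputable def reesForm (i : ℕ) (a : R) (ha : a ∈ I ^ i) : reesAlgebra I :=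
  ⟨Polynomial.monomial i a, reesAlgebra.monomial_mem.2 ha⟩

theorem reesForm_congr {i j : ℕ} {a b : R} {ha : a ∈ I ^ i} {hb : b ∈ I ^ j} (hij : i = j)
    (hab : a = b) : reesForm i a ha = reesForm j b hb := by
  subst hij hab; rfl

theorem reesForm_zero {i : ℕ} (h : (0 : R) ∈ I ^ i) : reesForm i 0 h = 0 :=
  Subtype.ext (map_zero (Polynomial.monomial i))

theorem reesForm_add {i : ℕ} {a b : R} (ha : a ∈ I ^ i) (hb : b ∈ I ^ i) (h : a + b ∈ I ^ i) :
    reesForm i (a + b) h = reesForm i a ha + reesForm i b hb :=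
  Subtype.ext (map_add (Polynomial.monomial i) a b)

theorem reesForm_smul {i : ℕ} (r : R) {a : R} (ha : a ∈ I ^ i) (h : r * a ∈ I ^ i) :
    reesForm i (r * a) h = algebraMap R (reesAlgebra I) r * reesForm i a ha :=
  Subtype.ext (Polynomial.C_mul_monomial).symm

theorem reesForm_mul {i j : ℕ} {a b : R} (ha : a ∈ I ^ i) (hb : b ∈ I ^ j)
    (h : a * b ∈ I ^ (i + j)) :
    reesForm i a ha * reesForm j b hb = reesForm (i + j) (a * b) h :=
  Subtype.ext (Polynomial.monomial_mul_monomial _ _ _ _)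

theorem reesForm_pow {i : ℕ} {a : R} (ha : a ∈ I ^ i) (n : ℕ) (h : a ^ n ∈ I ^ (i * n)) :
    reesForm i a ha ^ n = reesForm (i * n) (a ^ n) h :=
  Subtype.ext (by
    change Polynomial.monomial i a ^ n = _
    rw [Polynomial.monomial_pow]; rfl)

theorem reesAlgebra_eq_sum (s : reesAlgebra I) :
    s = ∑ i ∈ s.1.support, reesForm i (s.1.coeff i) ((mem_reesAlgebra_iff I s.1).1 s.2 i) := by
  refine Subtype.ext ?_
  rw [AddSubmonoidClass.coe_finsetSum]
  exact s.1.as_sum_support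

theorem coeff_mem_of_mem_map_irrelevantIdeal {s : reesAlgebra I}
    (hs : s ∈ (irrelevantIdeal 𝒜).map (algebraMap R (reesAlgebra I))) (i : ℕ) :
    s.1.coeff i ∈ irrelevantIdeal 𝒜 * I ^ i := by
  rw [Ideal.map] at hs
  induction hs using Submodule.span_induction generalizing i with
  | mem s hs =>
    obtain ⟨r, hr, rfl⟩ := hs
    change (Polynomial.C r).coeff i ∈ _
    rw [Polynomial.coeff_C]
    split_ifs with h
    · subst h; simpa using hr
    · exact Ideal.zero_mem _
  | zero => exact Ideal.zero_mem _
  | add s t _ _ hs ht =>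
    change (s.1 + t.1).coeff i ∈ _
    rw [Polynomial.coeff_add]
    exact Ideal.add_mem _ (hs i) (ht i)
  | smul a s _ hs =>
    change (a.1 * s.1).coeff i ∈ _
    rw [Polynomial.coeff_mul]
    refine Ideal.sum_mem _ fun x hx => ?_
    rw [← Finset.HasAntidiagonal.mem_antidiagonal.1 hx, pow_add, mul_left_comm]
    exact Ideal.mul_mem_mul ((mem_reesAlgebra_iff I a.1).1 a.2 x.1) (hs x.2)

variable {F : Type*} [CommRing F] {π : reesAlgebra I →+* F}

/-- Here π plays the quotient map onto ℱ(I), known only through its kernel. Since 𝔪 dies in the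
fiber, R acts there through its residue field k. -/
theorem IsStandardGraded.exists_map_algebraMap_eq (hR : IsStandardGraded 𝒜)
    (hker : RingHom.ker π = (irrelevantIdeal 𝒜).map (algebraMap R (reesAlgebra I))) (r : R) :
    ∃ c : k, π (algebraMap R (reesAlgebra I) r) = π (algebraMap k (reesAlgebra I) c) := by
  obtain ⟨c, hc⟩ := hR.exists_sub_mem_irrelevantIdeal r
  refine ⟨c, ?_⟩
  have : algebraMap R (reesAlgebra I) (r - algebraMap k R c) ∈ RingHom.ker π := by
    rw [hker]; exact Ideal.mem_map_of_mem _ hc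
  rw [RingHom.mem_ker, map_sub, map_sub, sub_eq_zero] at this
  rw [this, ← IsScalarTower.algebraMap_apply]

/-- The irrelevant maximal ideal of the fiber: the image of the preimage of 𝔪 under the
constant-coefficient map R[It] → R. -/
theorem IsStandardGraded.exists_isMaximal_fiber (hR : IsStandardGraded 𝒜)
    (hπ : Function.Surjective π)
    (hker : RingHom.ker π = (irrelevantIdeal 𝒜).map (algebraMap R (reesAlgebra I))) :
    ∃ M : Ideal F, M.IsMaximal ∧ ∀ s, π s ∈ M ↔ s.1.coeff 0 ∈ irrelevantIdeal 𝒜 := by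
  have := hR.irrelevantIdeal_isMaximal
  let c : reesAlgebra I →+* R := Polynomial.constantCoeff.comp (reesAlgebra I).toSubring.subtype
  have hc : ∀ s, c s = s.1.coeff 0 := fun _ => rfl
  have hcsurj : Function.Surjective c := fun r =>
    ⟨algebraMap R (reesAlgebra I) r, Polynomial.coeff_C_zero⟩
  have hmax := Ideal.comap_isMaximal_of_surjective c hcsurj (K := irrelevantIdeal 𝒜)
  have hle : RingHom.ker π ≤ (irrelevantIdeal 𝒜).comap c := by
    rw [hker, Ideal.map_le_iff_le_comap]
    intro r hr
    rw [Ideal.mem_comap, Ideal.mem_comap]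
    exact (congrArg (· ∈ irrelevantIdeal 𝒜) (Polynomial.coeff_C_zero (a := r))).mpr hr
  refine ⟨((irrelevantIdeal 𝒜).comap c).map π,
    Ideal.IsMaximal.map_of_surjective_of_ker_le hπ hle, fun s => ?_⟩
  rw [← Ideal.mem_comap, Ideal.comap_map_of_surjective' π hπ, sup_eq_left.2 hle, Ideal.mem_comap,
    hc]

theorem reesForm_mem_of_mem_span {ι : Type*} {f : ι → R} (hf : ∀ j, f j ∈ I ^ 1) {T : Set ι}
    {Q : Ideal (reesAlgebra I)} (hQ : ∀ j ∈ T, reesForm 1 (f j) (hf j) ∈ Q) {w : R}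
    (hw : w ∈ Ideal.span (f '' T)) (h : w ∈ I ^ 1) : reesForm 1 w h ∈ Q := by
  have hle : Ideal.span (f '' T) ≤ I ^ 1 := Ideal.span_le.2 (by rintro _ ⟨j, -, rfl⟩; exact hf j)
  induction hw using Submodule.span_induction with
  | mem x hx => obtain ⟨j, hj, rfl⟩ := hx; exact hQ j hj
  | zero => rw [reesForm_zero]; exact Q.zero_mem
  | add x y hx hy ihx ihy =>
    rw [reesForm_add (hle hx) (hle hy)]
    exact Q.add_mem (ihx _) (ihy _)
  | smul r x hx ihx =>
    have : reesForm 1 (r • x) h = algebraMap R _ r * reesForm 1 x (hle hx) := reesForm_smul r _ _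
    rw [this]
    exact Q.mul_mem_left _ (ihx _)

theorem reesForm_mul_mem {i j : ℕ} {L : Ideal R} (hL : L ≤ I ^ i)
    {Q : Ideal (reesAlgebra I)} (hQ : ∀ u (hu : u ∈ L), reesForm i u (hL hu) ∈ Q) {w : R}
    (hw : w ∈ L * I ^ j) (h : w ∈ I ^ (i + j)) : reesForm (i + j) w h ∈ Q := by
  have hle : L * I ^ j ≤ I ^ (i + j) := by rw [pow_add]; exact Ideal.mul_mono_left hL
  induction hw using Submodule.mul_induction_on' with
  | mem_mul_mem u hu b hb =>
    rw [← reesForm_mul (hL hu) hb]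
    exact Q.mul_mem_right _ (hQ u hu)
  | add x hx y hy ihx ihy =>
    rw [reesForm_add (hle hx) (hle hy)]
    exact Q.add_mem (ihx _) (ihy _)

/-- For u ∈ I, the power (ut)^(n+1) lies in J·I^n·t^(n+1), hence in P, so ut ∈ P by primality. In
the fiber this says that the f_j t generate an ideal whose radical contains the irrelevant ideal. -/
theorem mem_of_coeff_zero_mem_of_isPrime {l : ℕ} {f : Fin l → R} (hf : ∀ j, f j ∈ I ^ 1)
    (hJ : IsReduction (Ideal.span (Set.range f)) I) {P : Ideal (reesAlgebra I)} [P.IsPrime]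
    (hmP : (irrelevantIdeal 𝒜).map (algebraMap R (reesAlgebra I)) ≤ P)
    (hP : ∀ j, reesForm 1 (f j) (hf j) ∈ P) {s : reesAlgebra I}
    (hs0 : s.1.coeff 0 ∈ irrelevantIdeal 𝒜) : s ∈ P := by
  obtain ⟨hJI, n, hn⟩ := hJ
  have hJ1 : Ideal.span (Set.range f) ≤ I ^ 1 := by rwa [pow_one]
  have hspan : ∀ u (hu : u ∈ Ideal.span (Set.range f)), reesForm 1 u (hJ1 hu) ∈ P :=
    fun u hu => reesForm_mem_of_mem_span (T := Set.univ) hf (fun j _ => hP j)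
      (by rwa [Set.image_univ]) _
  have hform : ∀ u (hu : u ∈ I ^ 1), reesForm 1 u hu ∈ P := by
    intro u hu
    refine Ideal.IsPrime.mem_of_pow_mem ‹_› (1 + n) ?_
    have hpow : u ^ (1 + n) ∈ I ^ (1 + n) := Ideal.pow_mem_pow (by simpa using hu) _
    rw [reesForm_pow hu (1 + n) (by rwa [one_mul]),
      reesForm_congr (hb := hpow) (one_mul _) rfl]
    refine reesForm_mul_mem hJ1 hspan ?_ _
    rwa [hn, add_comm]
  rw [reesAlgebra_eq_sum s]
  refine Ideal.sum_mem _ fun i _ => ?_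
  have hs := (mem_reesAlgebra_iff I s.1).1 s.2 i
  rcases i with _ | i
  · exact hmP (Ideal.mem_map_of_mem _ hs0)
  · have hs' : s.1.coeff (i + 1) ∈ I ^ (1 + i) := by rwa [add_comm]
    rw [reesForm_congr (hb := hs') (add_comm i 1) rfl]
    refine reesForm_mul_mem le_rfl hform ?_ _
    rwa [← pow_add]

end SpecialFiber

/-! ### A Noether normalization of the special fiber -/

section Noether

variable {k R : Type*} [Field k] [CommRing R] [Algebra k R]
  {𝒜 : ℕ → Submodule k R} [GradedAlgebra 𝒜] {I : Ideal R} {F : Type*} [CommRing F]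
  {π : reesAlgebra I →+* F} {l : ℕ} {f : Fin l → R}

/-- The homomorphism `k[X₁, …, X_l] → R[It]` with `X_j ↦ f_j t`. -/
noncomputable def reesAeval (hf : ∀ j, f j ∈ I ^ 1) :
    MvPolynomial (Fin l) k →ₐ[k] reesAlgebra I :=
  MvPolynomial.aeval fun j => reesForm 1 (f j) (hf j)

theorem reesAeval_X (hf : ∀ j, f j ∈ I ^ 1) (j : Fin l) :
    reesAeval (k := k) hf (MvPolynomial.X j) = reesForm 1 (f j) (hf j) :=
  MvPolynomial.aeval_X _ _

/-- Because I^(n+m) = J^m I^n, module generators of I^i for i ≤ n, placed in degree i of the fiber,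
generate it over the polynomial ring. -/
theorem IsStandardGraded.finite_reesAeval (hR : IsStandardGraded 𝒜)
    (hπ : Function.Surjective π)
    (hker : RingHom.ker π = (irrelevantIdeal 𝒜).map (algebraMap R (reesAlgebra I)))
    (hf : ∀ j, f j ∈ I ^ 1) (hJ : IsReduction (Ideal.span (Set.range f)) I) :
    (π.comp (reesAeval (k := k) hf).toRingHom).Finite := by
  have := hR.isNoetherianRing
  obtain ⟨hJI, n, hn⟩ := hJ
  let _ := (π.comp (reesAeval (k := k) hf).toRingHom).toAlgebra
  have hsmul : ∀ (p : MvPolynomial (Fin l) k) (x : F), p • x = π (reesAeval hf p) * x :=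
    fun _ _ => rfl
  choose t ht using fun i : ℕ => IsNoetherian.noetherian (⊤ : Submodule R ↥(I ^ i))
  let G : Set F := ⋃ i ∈ Finset.range (n + 1),
    (fun a : ↥(I ^ i) => π (reesForm i a.1 a.2)) '' (t i : Set ↥(I ^ i))
  have hG : G.Finite := Set.Finite.biUnion (Finset.finite_toSet _)
    fun i _ => (Finset.finite_toSet _).image _
  let N : Submodule (MvPolynomial (Fin l) k) F := Submodule.span _ G
  -- N is a priori stable only under k[X]. Scalars from R act through k, so R-linear combinations
  -- stay in N.
  have hNR : ∀ (r : R) (x : F), x ∈ N → π (algebraMap R (reesAlgebra I) r) * x ∈ N := by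
    intro r x hx
    obtain ⟨c, hc⟩ := hR.exists_map_algebraMap_eq hker r
    have h := N.smul_mem (MvPolynomial.C c) hx
    rw [hsmul] at h
    rw [hc]
    convert h using 3
    exact ((reesAeval (k := k) hf).commutes c).symm
  have hsmall : ∀ i ≤ n, ∀ a (ha : a ∈ I ^ i), π (reesForm i a ha) ∈ N := by
    intro i hi a ha
    have hmem : (⟨a, ha⟩ : ↥(I ^ i)) ∈ Submodule.span R (t i : Set ↥(I ^ i)) := by
      rw [ht]; trivial
    suffices h : ∀ b ∈ Submodule.span R (t i : Set ↥(I ^ i)), π (reesForm i b.1 b.2) ∈ N from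
      h _ hmem
    intro b hb
    induction hb using Submodule.span_induction with
    | mem b hb =>
      exact Submodule.subset_span (Set.mem_biUnion (Finset.mem_coe.2 (Finset.mem_range.2
        (Nat.lt_succ_of_le hi))) ⟨b, hb, rfl⟩)
    | zero =>
      have : reesForm i (0 : ↥(I ^ i)).1 (0 : ↥(I ^ i)).2 = 0 := reesForm_zero _
      rw [this, map_zero]
      exact N.zero_mem
    | add x y _ _ hx hy =>
      have : reesForm i (x + y).1 (x + y).2 = reesForm i x.1 x.2 + reesForm i y.1 y.2 :=
        reesForm_add _ _ _
      rw [this, map_add]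
      exact N.add_mem hx hy
    | smul r x _ hx =>
      have : reesForm i (r • x).1 (r • x).2 = algebraMap R _ r * reesForm i x.1 x.2 :=
        reesForm_smul r _ _
      rw [this, map_mul]
      exact hNR r _ hx
  have hbig : ∀ m a (ha : a ∈ I ^ (n + m)), π (reesForm (n + m) a ha) ∈ N := by
    intro m
    induction m with
    | zero => exact hsmall n le_rfl
    | succ m ih =>
      have hle : ∀ u ∈ Ideal.span (Set.range f), ∀ b ∈ I ^ (n + m), u * b ∈ I ^ (1 + (n + m)) :=
        fun u hu b hb => by
          rw [pow_add, pow_one]; exact Ideal.mul_mem_mul (hJI hu) hb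
      have hprod : ∀ u (hu : u ∈ Ideal.span (Set.range f)), ∀ b (hb : b ∈ I ^ (n + m)),
          π (reesForm (1 + (n + m)) (u * b) (hle u hu b hb)) ∈ N := by
        intro u hu
        induction hu using Submodule.span_induction with
        | mem u hu =>
          obtain ⟨j, rfl⟩ := hu
          intro b hb
          rw [← reesForm_mul (hf j) hb, map_mul, ← reesAeval_X (k := k) hf j, ← hsmul]
          exact N.smul_mem _ (ih b hb)
        | zero =>
          intro b hb
          rw [reesForm_congr (hb := Ideal.zero_mem _) rfl (zero_mul b), reesForm_zero, map_zero]
          exact N.zero_mem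
        | add x y hx hy ihx ihy =>
          intro b hb
          rw [reesForm_congr (hb := by rw [← add_mul]; exact hle _ (add_mem hx hy) b hb) rfl
            (add_mul x y b), reesForm_add (hle x hx b hb) (hle y hy b hb), map_add]
          exact N.add_mem (ihx b hb) (ihy b hb)
        | smul r x hx ihx =>
          intro b hb
          have hrb := Ideal.mul_mem_left (I ^ (n + m)) r hb
          rw [reesForm_congr (hb := hle x hx _ hrb) rfl
            (show r • x * b = x * (r * b) by rw [smul_eq_mul]; ring)]
          exact ihx _ hrb
      intro a ha
      have ha1 : a ∈ Ideal.span (Set.range f) * I ^ (n + m) := by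
        rw [pow_add, ← mul_assoc, hn, ← pow_add]
        convert ha using 2
        ring
      have ha2 : a ∈ I ^ (1 + (n + m)) := by rwa [add_comm 1, add_assoc]
      rw [reesForm_congr (hb := ha2) (by ring) rfl]
      have hle' : Ideal.span (Set.range f) * I ^ (n + m) ≤ I ^ (1 + (n + m)) :=
        Ideal.mul_le.2 hle
      clear ha
      induction ha1 using Submodule.mul_induction_on' with
      | mem_mul_mem u hu b hb => exact hprod u hu b hb
      | add x hx y hy ihx ihy =>
        rw [reesForm_add (hle' hx) (hle' hy), map_add]
        exact N.add_mem (ihx _) (ihy _)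
  suffices h : (⊤ : Submodule (MvPolynomial (Fin l) k) F).FG from ⟨h⟩
  refine Submodule.fg_def.2 ⟨G, hG, (eq_top_iff.2 fun x _ => ?_)⟩
  obtain ⟨s, rfl⟩ := hπ x
  rw [reesAlgebra_eq_sum s, map_sum]
  refine N.sum_mem fun i _ => ?_
  rcases le_total i n with h | h
  · exact hsmall i h _ _
  · obtain ⟨m, rfl⟩ := Nat.exists_eq_add_of_le h
    exact hbig m _ _

theorem reesAeval_coeff (hf : ∀ j, f j ∈ I ^ 1) (p : MvPolynomial (Fin l) k) (N : ℕ) :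
    (reesAeval hf p).1.coeff N =
      MvPolynomial.aeval f (MvPolynomial.homogeneousComponent N p) := by
  have hcoe : ∀ q : MvPolynomial (Fin l) k, (reesAeval hf q).1 =
      MvPolynomial.aeval (fun j => Polynomial.monomial 1 (f j)) q := by
    intro q
    induction q using MvPolynomial.induction_on with
    | C c =>
      rw [MvPolynomial.aeval_C]
      exact congrArg Subtype.val ((reesAeval (k := k) hf).commutes c)
    | add p q hp hq =>
      rw [map_add, map_add, ← hp, ← hq]; rfl
    | mul_X p j hp =>
      rw [map_mul, map_mul, ← hp, MvPolynomial.aeval_X, reesAeval_X]; rfl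
  rw [hcoe]
  induction p using MvPolynomial.induction_on' with
  | monomial a c =>
    have h1 : MvPolynomial.aeval (fun j => Polynomial.monomial 1 (f j))
        (MvPolynomial.monomial a c) =
        Polynomial.monomial a.degree (MvPolynomial.aeval f (MvPolynomial.monomial a c)) := by
      rw [MvPolynomial.aeval_monomial, MvPolynomial.aeval_monomial]
      simp only [Finsupp.prod, Polynomial.monomial_pow, one_mul]
      have h2 : ∀ s : Finset (Fin l), ∏ x ∈ s, Polynomial.monomial (a x) (f x ^ a x) =
          Polynomial.monomial (∑ x ∈ s, a x) (∏ x ∈ s, f x ^ a x) := by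
        intro s
        induction s using Finset.induction_on with
        | empty => simp
        | insert i s hi ih =>
          rw [Finset.prod_insert hi, ih, Polynomial.monomial_mul_monomial, Finset.sum_insert hi,
            Finset.prod_insert hi]
      rw [h2]
      rw [IsScalarTower.algebraMap_apply k R (Polynomial R), Polynomial.algebraMap_eq,
        Polynomial.C_mul_monomial]
      rfl
    rw [h1, Polynomial.coeff_monomial]
    split_ifs with h
    · rw [MvPolynomial.homogeneousComponent_of_mem
        (MvPolynomial.isHomogeneous_monomial c h), if_pos rfl]
    · rw [MvPolynomial.homogeneousComponent_of_mem
        (MvPolynomial.isHomogeneous_monomial c rfl), if_neg (Ne.symm h), map_zero]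
  | add p q hp hq => rw [map_add, Polynomial.coeff_add, hp, hq, map_add, map_add]

theorem MvPolynomial.IsHomogeneous.aeval_mem_graded {d N : ℕ} (hf : ∀ j, f j ∈ 𝒜 d)
    {p : MvPolynomial (Fin l) k} (hp : p.IsHomogeneous N) :
    MvPolynomial.aeval f p ∈ 𝒜 (N * d) := by
  rw [MvPolynomial.aeval_def, MvPolynomial.eval₂_eq]
  refine Submodule.sum_mem _ fun a ha => ?_
  rw [← Algebra.smul_def]
  refine Submodule.smul_mem _ _ ?_
  rw [hp.degree_eq_sum_deg_support ha]
  have h : ∀ s : Finset (Fin l), ∏ i ∈ s, f i ^ a i ∈ 𝒜 ((∑ i ∈ s, a i) * d) := by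
    intro s
    induction s using Finset.induction_on with
    | empty => simpa using SetLike.GradedOne.one_mem
    | insert i s hi ih =>
      rw [Finset.prod_insert hi, Finset.sum_insert hi, add_mul]
      exact SetLike.mul_mem_graded (by simpa using SetLike.pow_mem_graded (a i) (hf i)) ih
  exact h _

theorem IsEquigenerated.pow_eq_span {d : ℕ} (hd : IsEquigenerated 𝒜 I d) (N : ℕ) :
    ∃ U : Submodule k R, U ≤ 𝒜 (N * d) ∧ Ideal.span (U : Set R) = I ^ N := by
  refine ⟨degPart 𝒜 I d ^ N, ?_, ?_⟩
  · induction N with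
    | zero =>
      rw [pow_zero, zero_mul, Submodule.one_le]
      exact SetLike.GradedOne.one_mem
    | succ N ih =>
      rw [pow_succ, add_mul, one_mul]
      exact Submodule.mul_le.2 fun a ha b hb => SetLike.mul_mem_graded (ih ha) hb.2
  · induction N with
    | zero =>
      rw [pow_zero, pow_zero, Ideal.one_eq_top, Ideal.eq_top_iff_one]
      exact Ideal.subset_span (Submodule.one_le.1 le_rfl)
    | succ N ih =>
      rw [pow_succ, pow_succ, Submodule.mul_eq_span_mul_set, Ideal.span_coe_span_eq,
        ← Ideal.span_mul_span', ih]
      exact congrArg (_ * ·) hd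

theorem GradedAlgebra.proj_eq_zero_of_mem_irrelevantIdeal_mul {e : ℕ} {U : Submodule k R}
    (hU : U ≤ 𝒜 e) {L : Ideal R} (hL : Ideal.span (U : Set R) = L) {x : R}
    (hx : x ∈ irrelevantIdeal 𝒜 * L) : GradedAlgebra.proj 𝒜 e x = 0 := by
  subst hL
  induction hx using Submodule.mul_induction_on' with
  | mem_mul_mem r hr y hy =>
    rw [GradedAlgebra.proj_mul_of_mem_span hU hy, mem_irrelevantIdeal_iff.1 hr, zero_mul]
  | add x _ y _ hx hy => rw [map_add, hx, hy, add_zero]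

/-- For p in the kernel, each homogeneous component satisfies p_N(f) ∈ 𝔪I^N. It is a form of degree
Nd, the degree in which I^N is generated, so it vanishes, and minimality of the reduction gives p_N
= 0. -/
theorem IsMinimalReduction.injective_reesAeval [Infinite k] [Nontrivial R] {d : ℕ}
    (hd : IsEquigenerated 𝒜 I d)
    (hker : RingHom.ker π = (irrelevantIdeal 𝒜).map (algebraMap R (reesAlgebra I)))
    (hf : ∀ j, f j ∈ I ^ 1) (hfd : ∀ j, f j ∈ 𝒜 d)
    (hJ : IsMinimalReduction 𝒜 (Ideal.span (Set.range f)) I)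
    (hl : l = minGens (Ideal.span (Set.range f))) :
    Function.Injective (π.comp (reesAeval (k := k) hf).toRingHom) := by
  rw [injective_iff_map_eq_zero]
  intro p hp
  have hmem : reesAeval hf p ∈ RingHom.ker π := hp
  rw [hker] at hmem
  rw [← MvPolynomial.sum_homogeneousComponent p]
  refine Finset.sum_eq_zero fun N _ => ?_
  have h1 := coeff_mem_of_mem_map_irrelevantIdeal hmem N
  rw [reesAeval_coeff] at h1
  have hhom := MvPolynomial.homogeneousComponent_isHomogeneous N p
  obtain ⟨U, hU, hspan⟩ := hd.pow_eq_span N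
  have h2 := GradedAlgebra.proj_eq_zero_of_mem_irrelevantIdeal_mul hU hspan h1
  rw [GradedAlgebra.proj_of_mem (hhom.aeval_mem_graded hfd)] at h2
  exact hJ.eq_zero_of_aeval_eq_zero hfd hl hhom h2

end Noether

/-! ### Dimension and height along finite ring maps -/

section Dimension

theorem RingHom.Finite.ringKrullDim_le {A F : Type*} [CommRing A] [CommRing F]
    {φ : A →+* F} (hφ : φ.Finite) : ringKrullDim F ≤ ringKrullDim A := by
  let _ := φ.toAlgebra
  have : Algebra.IsIntegral A F := ⟨hφ.to_isIntegral⟩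
  refine Order.krullDim_le_of_strictMono (fun P : PrimeSpectrum F => P.comap φ) fun P Q hPQ => ?_
  exact Ideal.IsIntegral.comap_lt_comap (R := A) (I := P.asIdeal) (J := Q.asIdeal) hPQ

/-- The kernel of the homomorphism sending the first `i` variables to zero. -/
noncomputable def MvPolynomial.initialPrime (k : Type*) [Field k] (l i : ℕ) :
    Ideal (MvPolynomial (Fin l) k) :=
  RingHom.ker (MvPolynomial.aeval (R := k)
    fun j : Fin l => if j.1 < i then (0 : MvPolynomial (Fin l) k) else MvPolynomial.X j)

variable {k : Type*} [Field k] {l : ℕ}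

instance MvPolynomial.initialPrime_isPrime (i : ℕ) : (initialPrime k l i).IsPrime :=
  RingHom.ker_isPrime _

theorem MvPolynomial.X_mem_initialPrime_iff {i : ℕ} {j : Fin l} :
    MvPolynomial.X j ∈ initialPrime k l i ↔ j.1 < i := by
  rw [initialPrime, RingHom.mem_ker, MvPolynomial.aeval_X]
  split_ifs with h
  · simp [h]
  · simp [h, MvPolynomial.X_ne_zero]

theorem MvPolynomial.initialPrime_zero : initialPrime k l 0 = ⊥ := by
  rw [eq_bot_iff]
  intro p hp
  rw [initialPrime, RingHom.mem_ker] at hp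
  simpa using hp

theorem MvPolynomial.initialPrime_lt {i : ℕ} (hi : i < l) :
    initialPrime k l i < initialPrime k l (i + 1) := by
  refine lt_of_le_of_ne (fun p hp => ?_) fun h => ?_
  · rw [initialPrime, RingHom.mem_ker] at hp ⊢
    have hcomp : (MvPolynomial.aeval (R := k) fun j : Fin l =>
        if j.1 < i + 1 then (0 : MvPolynomial (Fin l) k) else MvPolynomial.X j).comp
        (MvPolynomial.aeval (R := k) fun j : Fin l =>
          if j.1 < i then (0 : MvPolynomial (Fin l) k) else MvPolynomial.X j) =
        MvPolynomial.aeval (R := k) fun j : Fin l =>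
          if j.1 < i + 1 then (0 : MvPolynomial (Fin l) k) else MvPolynomial.X j := by
      refine MvPolynomial.algHom_ext fun j => ?_
      rw [AlgHom.comp_apply, MvPolynomial.aeval_X, MvPolynomial.aeval_X]
      split_ifs with h1 h2 h2
      · rw [map_zero]
      · omega
      · rw [MvPolynomial.aeval_X, if_pos h2]
      · rw [MvPolynomial.aeval_X, if_neg h2]
    rw [← hcomp, AlgHom.comp_apply, hp, map_zero]
  · have h1 : (MvPolynomial.X (⟨i, hi⟩ : Fin l) : MvPolynomial (Fin l) k) ∈
        initialPrime k l (i + 1) := X_mem_initialPrime_iff.2 (Nat.lt_succ_self i)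
    rw [← h, X_mem_initialPrime_iff] at h1
    exact lt_irrefl _ h1

/-- Lying over and going up lift the chain of coordinate primes to F. Inclusions stay strict because
the contractions differ, so the top prime, which contains all variables, has height at least l. -/
theorem exists_prime_height_of_injective_of_finite {F : Type*} [CommRing F]
    {φ : MvPolynomial (Fin l) k →+* F} (hφ : φ.Finite) (hinj : Function.Injective φ) :
    ∃ Q : Ideal F, Q.IsPrime ∧ (∀ j, φ (MvPolynomial.X j) ∈ Q) ∧ (l : ℕ∞) ≤ Q.height := by
  let _ := φ.toAlgebra
  have : Algebra.IsIntegral (MvPolynomial (Fin l) k) F := ⟨hφ.to_isIntegral⟩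
  have key : ∀ i ≤ l, ∃ Q : Ideal F, Q.IsPrime ∧
      Q.comap (algebraMap (MvPolynomial (Fin l) k) F) = MvPolynomial.initialPrime k l i ∧
      (i : ℕ∞) ≤ Q.height := by
    intro i
    induction i with
    | zero =>
      intro _
      obtain ⟨Q, -, hQ, hcomap⟩ := Ideal.exists_ideal_over_prime_of_isIntegral
        (MvPolynomial.initialPrime k l 0) (⊥ : Ideal F) (by
          rw [MvPolynomial.initialPrime_zero]
          exact ((RingHom.injective_iff_ker_eq_bot _).1 hinj).le)
      exact ⟨Q, hQ, hcomap, bot_le⟩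
    | succ i ih =>
      intro hi
      obtain ⟨P, hP, hcomap, hht⟩ := ih (by omega)
      have hlt := MvPolynomial.initialPrime_lt (k := k) (show i < l by omega)
      obtain ⟨Q, hPQ, hQ, hcomap'⟩ := Ideal.exists_ideal_over_prime_of_isIntegral_of_isPrime
        (MvPolynomial.initialPrime k l (i + 1)) P (by rw [hcomap]; exact hlt.le)
      have hPQ' : P < Q := lt_of_le_of_ne hPQ fun h => by
        rw [← hcomap, ← hcomap', h] at hlt
        exact lt_irrefl _ hlt
      refine ⟨Q, hQ, hcomap', ?_⟩
      push_cast
      exact (add_le_add_left hht 1).trans (Ideal.height_add_one_le_of_lt_of_isPrime hPQ')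
  obtain ⟨Q, hQ, hcomap, hht⟩ := key l le_rfl
  refine ⟨Q, hQ, fun j => ?_, hht⟩
  have : MvPolynomial.X j ∈ Q.comap (algebraMap (MvPolynomial (Fin l) k) F) := by
    rw [hcomap]; exact MvPolynomial.X_mem_initialPrime_iff.2 j.2
  exact this

end Dimension

/-! ### Minimal reductions with Cohen–Macaulay fiber -/

section AnalyticallyAdjusted

variable {k R : Type*} [Field k] [CommRing R] [Algebra k R]
  {𝒜 : ℕ → Submodule k R} [GradedAlgebra 𝒜] {I : Ideal R} {F : Type*} [CommRing F]
  {π : reesAlgebra I →+* F} {l d : ℕ} {f : Fin l → R}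

theorem IsReduction.le_of_isPrime
    (hker : RingHom.ker π = (irrelevantIdeal 𝒜).map (algebraMap R (reesAlgebra I)))
    (hf : ∀ j, f j ∈ I ^ 1) (hJ : IsReduction (Ideal.span (Set.range f)) I)
    (hπ : Function.Surjective π) {M : Ideal F}
    (hM : ∀ s, π s ∈ M ↔ s.1.coeff 0 ∈ irrelevantIdeal 𝒜) {P : Ideal F} [P.IsPrime]
    (hP : ∀ j, π (reesForm 1 (f j) (hf j)) ∈ P) : M ≤ P := by
  intro x hx
  obtain ⟨s, rfl⟩ := hπ x
  refine mem_of_coeff_zero_mem_of_isPrime (𝒜 := 𝒜) hf hJ (P := P.comap π) ?_ hP ((hM s).1 hx)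
  rw [← hker]
  exact Ideal.comap_mono bot_le

/-- The prime of height at least l obtained by going up contains every f_j t, hence contains M and
equals it. -/
theorem IsMinimalReduction.le_height [Infinite k] (hR : IsStandardGraded 𝒜)
    (hd : IsEquigenerated 𝒜 I d) (hπ : Function.Surjective π)
    (hker : RingHom.ker π = (irrelevantIdeal 𝒜).map (algebraMap R (reesAlgebra I)))
    (hf : ∀ j, f j ∈ I ^ 1) (hfd : ∀ j, f j ∈ 𝒜 d)
    (hJ : IsMinimalReduction 𝒜 (Ideal.span (Set.range f)) I)
    (hl : l = minGens (Ideal.span (Set.range f))) {M : Ideal F} [M.IsMaximal]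
    (hM : ∀ s, π s ∈ M ↔ s.1.coeff 0 ∈ irrelevantIdeal 𝒜) : (l : ℕ∞) ≤ M.height := by
  have := hR.nontrivial
  have hfin := hR.finite_reesAeval hπ hker hf hJ.2.1
  have hinj := hJ.injective_reesAeval hd hker hf hfd hl
  obtain ⟨Q, hQ, hX, hht⟩ := exists_prime_height_of_injective_of_finite hfin hinj
  have hX' : ∀ j, π (reesForm 1 (f j) (hf j)) ∈ Q := fun j => by
    rw [← reesAeval_X (k := k) hf j]; exact hX j
  have hle : M ≤ Q := hJ.2.1.le_of_isPrime hker hf hπ hM hX'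
  rwa [Ideal.IsMaximal.eq_of_le ‹_› hQ.ne_top hle]

theorem IsMinimalReduction.ringKrullDim_eq [Infinite k] (hR : IsStandardGraded 𝒜)
    (hd : IsEquigenerated 𝒜 I d) (hπ : Function.Surjective π)
    (hker : RingHom.ker π = (irrelevantIdeal 𝒜).map (algebraMap R (reesAlgebra I)))
    (hf : ∀ j, f j ∈ I ^ 1) (hfd : ∀ j, f j ∈ 𝒜 d)
    (hJ : IsMinimalReduction 𝒜 (Ideal.span (Set.range f)) I)
    (hl : l = minGens (Ideal.span (Set.range f))) : ringKrullDim F = l := by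
  refine le_antisymm ?_ ?_
  · refine (hR.finite_reesAeval hπ hker hf hJ.2.1).ringKrullDim_le.trans ?_
    rw [MvPolynomial.ringKrullDim_of_isNoetherianRing, ringKrullDim_eq_zero_of_field, zero_add,
      Nat.card_fin]
  · obtain ⟨M, hMmax, hM⟩ := hR.exists_isMaximal_fiber hπ hker
    have h := hJ.le_height hR hd hπ hker hf hfd hl hM
    exact le_trans (by exact_mod_cast h) Ideal.height_le_ringKrullDim_of_isPrime

theorem coeff_one_mem_of_mem_span {ι : Type*} {f : ι → R} (hf : ∀ j, f j ∈ I ^ 1) {T : Set ι}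
    {q : reesAlgebra I} (hq : q ∈ Ideal.span ((fun j => reesForm 1 (f j) (hf j)) '' T)) :
    q.1.coeff 0 = 0 ∧ q.1.coeff 1 ∈ Ideal.span (f '' T) := by
  induction hq using Submodule.span_induction with
  | mem q hq =>
    obtain ⟨j, hj, rfl⟩ := hq
    refine ⟨Polynomial.coeff_monomial_of_ne _ (by norm_num), ?_⟩
    change (Polynomial.monomial 1 (f j)).coeff 1 ∈ _
    rw [Polynomial.coeff_monomial_same]
    exact Ideal.subset_span ⟨j, hj, rfl⟩
  | zero => exact ⟨rfl, Ideal.zero_mem _⟩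
  | add p q _ _ hp hq =>
    refine ⟨?_, ?_⟩
    · change (p.1 + q.1).coeff 0 = 0
      rw [Polynomial.coeff_add, hp.1, hq.1, add_zero]
    · change (p.1 + q.1).coeff 1 ∈ _
      rw [Polynomial.coeff_add]
      exact Ideal.add_mem _ hp.2 hq.2
  | smul a q _ hq =>
    refine ⟨?_, ?_⟩
    · change (a.1 * q.1).coeff 0 = 0
      rw [Polynomial.mul_coeff_zero, hq.1, mul_zero]
    · change (a.1 * q.1).coeff 1 ∈ _
      rw [Polynomial.mul_coeff_one, hq.1, mul_zero, add_zero]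
      exact Ideal.mul_mem_left _ _ hq.2

/-- The coefficient of t in a lift of the relation gives s₀g − q₁ ∈ 𝔪I, which has no component in
degree d. Hence c·g is the degree-d part of q₁, where c, the constant term of s₀, is nonzero because
s ∉ M. -/
theorem IsStandardGraded.mem_span_of_mul_mem (hR : IsStandardGraded 𝒜)
    (hd : IsEquigenerated 𝒜 I d) (hπ : Function.Surjective π)
    (hker : RingHom.ker π = (irrelevantIdeal 𝒜).map (algebraMap R (reesAlgebra I)))
    {ι : Type*} {f : ι → R} (hf : ∀ j, f j ∈ I ^ 1) (hfd : ∀ j, f j ∈ 𝒜 d) {T : Set ι}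
    {M : Ideal F} (hM : ∀ s, π s ∈ M ↔ s.1.coeff 0 ∈ irrelevantIdeal 𝒜) {g : R}
    (hg : g ∈ I ^ 1) (hgd : g ∈ 𝒜 d) {s : F} (hs : s ∉ M)
    (h : s * π (reesForm 1 g hg) ∈
      (Ideal.span ((fun j => reesForm 1 (f j) (hf j)) '' T)).map π) :
    g ∈ Submodule.span k (f '' T) := by
  obtain ⟨s, rfl⟩ := hπ s
  rw [← map_mul] at h
  obtain ⟨q, hq, hqs⟩ := (Ideal.mem_map_iff_of_surjective π hπ).1 h
  have hmem : s * reesForm 1 g hg - q ∈ RingHom.ker π := by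
    rw [RingHom.mem_ker, map_sub, hqs, sub_self]
  rw [hker] at hmem
  have h1 := coeff_mem_of_mem_map_irrelevantIdeal hmem 1
  have h2 : (s * reesForm 1 g hg - q).1.coeff 1 = s.1.coeff 0 * g - q.1.coeff 1 := by
    change (s.1 * Polynomial.monomial 1 g - q.1).coeff 1 = _
    rw [Polynomial.coeff_sub, Polynomial.mul_coeff_one, Polynomial.coeff_monomial_same,
      Polynomial.coeff_monomial_of_ne _ (by norm_num), mul_zero, add_zero]
  rw [h2] at h1
  have hdeg : Ideal.span (degPart 𝒜 I d : Set R) = I ^ 1 := by rw [pow_one]; exact hd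
  have h3 := GradedAlgebra.proj_eq_zero_of_mem_irrelevantIdeal_mul (𝒜 := 𝒜) (e := d)
    inf_le_right hdeg h1
  rw [map_sub, GradedAlgebra.proj_mul_of_mem _ hgd, sub_eq_zero] at h3
  obtain ⟨c, hc⟩ := hR.exists_proj_zero (s.1.coeff 0)
  have hc0 : c ≠ 0 := by
    rintro rfl
    rw [map_zero, ← mem_irrelevantIdeal_iff, ← hM] at hc
    exact hs hc
  have hle : Submodule.span k (f '' T) ≤ 𝒜 d :=
    Submodule.span_le.2 (by rintro _ ⟨j, -, rfl⟩; exact hfd j)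
  have h4 : GradedAlgebra.proj 𝒜 d (q.1.coeff 1) ∈ Submodule.span k (f '' T) := by
    refine hR.proj_mem_of_mem_span hle ?_
    rw [Ideal.span_coe_span_eq]
    exact (coeff_one_mem_of_mem_span hf hq).2
  rw [← h3, hc, ← Algebra.smul_def] at h4
  have h5 := Submodule.smul_mem _ c⁻¹ h4
  rwa [inv_smul_smul₀ hc0] at h5

theorem Ideal.ofList_ofFn {A : Type*} [CommRing A] {l : ℕ} (f : Fin l → A) :
    Ideal.ofList (List.ofFn f) = Ideal.span (Set.range f) := by
  rw [Ideal.ofList]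
  congr 1
  ext x
  simp [List.mem_ofFn]

/-- At M the depth equals the height, so there is a regular sequence of length l. The y_j generate
an M-primary ideal there and so form a regular sequence themselves; s is the denominator cleared on
returning to A. -/
theorem isRegularMod_localization_of_le_height {A : Type*} [CommRing A] [IsNoetherianRing A]
    {M : Ideal A} [M.IsMaximal] {l : ℕ} {y : Fin l → A}
    (hdepth : ((localDepth (Localization.AtPrime M) : ℕ∞) : WithBot ℕ∞) =
      ringKrullDim (Localization.AtPrime M))
    (hht : (l : ℕ∞) ≤ M.height) (hy : ∀ j, y j ∈ M)
    (hprime : ∀ P : Ideal A, P.IsPrime → (∀ j, y j ∈ P) → M ≤ P) (i : Fin l) {b : A}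
    (hb : y i * b ∈ Ideal.span (y '' Set.Iio i)) :
    ∃ s ∉ M, s * b ∈ Ideal.span (y '' Set.Iio i) := by
  set B := Localization.AtPrime M
  have : IsNoetherianRing B := IsLocalization.isNoetherianRing M.primeCompl B inferInstance
  rw [IsLocalization.AtPrime.ringKrullDim_eq_height M B] at hdepth
  have hreg : HasRegSeq l (⊥ : Ideal B) := by
    refine hasRegSeq_of_le_localDepth ?_
    rwa [show localDepth B = M.height by exact_mod_cast hdepth]
  let ys : Fin l → B := fun j => algebraMap A B (y j)
  have hys : ∀ z ∈ List.ofFn ys, z ∈ maximalIdeal B := by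
    intro z hz
    obtain ⟨j, rfl⟩ := (List.mem_ofFn' ys z).1 hz
    exact (IsLocalization.AtPrime.to_map_mem_maximal_iff B M (y j)).2 (hy j)
  have hrad : maximalIdeal B ≤ (⊥ ⊔ Ideal.ofList (List.ofFn ys)).radical := by
    rw [bot_sup_eq, Ideal.ofList_ofFn, ← Localization.AtPrime.map_eq_maximalIdeal,
      Ideal.map_le_iff_le_comap]
    have h1 : M ≤ (Ideal.span (Set.range y)).radical := by
      rw [Ideal.radical_eq_sInf]
      exact le_sInf fun P hP => hprime P hP.2 fun j => hP.1 (Ideal.subset_span ⟨j, rfl⟩)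
    intro x hx
    obtain ⟨n, hn⟩ := h1 hx
    refine ⟨n, ?_⟩
    rw [← map_pow]
    have := Ideal.mem_map_of_mem (algebraMap A B) hn
    rwa [Ideal.map_span, ← Set.range_comp] at this
  have key := HasRegSeq.isRegularMod_of_primary (List.ofFn ys) ⊥ (by rwa [List.length_ofFn]) hys
    hrad i (by simp)
  rw [bot_sup_eq, Ideal.ofList_take_ofFn, List.getElem_ofFn] at key
  have hspan : Ideal.span (ys '' Set.Iio i) =
      (Ideal.span (y '' Set.Iio i)).map (algebraMap A B) := by
    rw [Ideal.map_span, ← Set.image_comp]; rfl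
  rw [hspan] at key
  have h1 : algebraMap A B b ∈ (Ideal.span (y '' Set.Iio i)).map (algebraMap A B) := by
    refine key _ ?_
    have := Ideal.mem_map_of_mem (algebraMap A B) hb
    rwa [map_mul] at this
  obtain ⟨s, hs, hsb⟩ := (IsLocalization.algebraMap_mem_map_algebraMap_iff M.primeCompl B _ _).1 h1
  exact ⟨s, hs, hsb⟩

theorem IsMinimalReduction.isAdjusted [Infinite k] (hR : IsStandardGraded 𝒜)
    (hd : IsEquigenerated 𝒜 I d) (hπ : Function.Surjective π)
    (hker : RingHom.ker π = (irrelevantIdeal 𝒜).map (algebraMap R (reesAlgebra I)))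
    (hCM : IsCohenMacaulayRing F) (hf : ∀ j, f j ∈ degPart 𝒜 I d)
    (hJ : IsMinimalReduction 𝒜 (Ideal.span (Set.range f)) I)
    (hl : l = minGens (Ideal.span (Set.range f))) : IsAdjusted 𝒜 I d f := by
  have hfd : ∀ j, f j ∈ 𝒜 d := fun j => (hf j).2
  have hf1 : ∀ j, f j ∈ I ^ 1 := fun j => by rw [pow_one]; exact (hf j).1
  obtain ⟨hnoeth, hdepth⟩ := hCM
  obtain ⟨M, hMmax, hM⟩ := hR.exists_isMaximal_fiber hπ hker
  have hht := hJ.le_height hR hd hπ hker hf1 hfd hl hM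
  -- The span of the l forms has dimension μ(J) = l.
  have hli : LinearIndependent k f := by
    rw [linearIndependent_iff_card_eq_finrank_span, Fintype.card_fin, Set.finrank]
    conv_lhs => rw [hl]
    rw [← hR.minGens_span (Submodule.span_le.2 (by rintro _ ⟨j, rfl⟩; exact hfd j))
      (Submodule.fg_span (Set.finite_range f)), Ideal.span_coe_span_eq]
  refine hR.isAdjusted hd hf hli fun i g hg hgf => ?_
  have hg1 : g ∈ I ^ 1 := by rw [pow_one]; exact hg.1
  let y : Fin l → F := fun j => π (reesForm 1 (f j) (hf1 j))
  have hy : ∀ j, y j ∈ M := fun j => by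
    rw [hM]
    have : (reesForm 1 (f j) (hf1 j)).1.coeff 0 = 0 :=
      Polynomial.coeff_monomial_of_ne _ (by norm_num)
    rw [this]
    exact Ideal.zero_mem _
  have hspan : Ideal.span (y '' Set.Iio i) =
      (Ideal.span ((fun j => reesForm 1 (f j) (hf1 j)) '' Set.Iio i)).map π := by
    rw [Ideal.map_span, ← Set.image_comp]; rfl
  have hL1 : Ideal.span (f '' Set.Iio i) ≤ I ^ 1 :=
    Ideal.span_le.2 (by rintro _ ⟨j, -, rfl⟩; exact hf1 j)
  have hb : y i * π (reesForm 1 g hg1) ∈ Ideal.span (y '' Set.Iio i) := by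
    have hmul : g * f i ∈ Ideal.span (f '' Set.Iio i) * I ^ 1 := by
      have hle : degPart 𝒜 I d * Submodule.span k (f '' Set.Iio i) ≤
          (Ideal.span (f '' Set.Iio i) * I ^ 1).restrictScalars k := by
        refine Submodule.mul_le.2 fun v hv w hw => ?_
        rw [Submodule.restrictScalars_mem, mul_comm v w]
        refine Ideal.mul_mem_mul ?_ (by rw [pow_one]; exact hv.1)
        rw [← Ideal.span_coe_span_eq (k := k)]
        exact Ideal.subset_span hw
      exact hle hgf
    have hmul2 : f i * g ∈ Ideal.span (f '' Set.Iio i) * I ^ 1 := by rwa [mul_comm (f i) g]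
    rw [hspan, ← map_mul, reesForm_mul (hf1 i) hg1 (by
      rw [pow_add]; exact Ideal.mul_mem_mul (hf1 i) hg1)]
    refine Ideal.mem_map_of_mem π (reesForm_mul_mem hL1 (fun u hu => ?_) hmul2 _)
    exact reesForm_mem_of_mem_span hf1
      (fun j hj => Ideal.subset_span (Set.mem_image_of_mem _ hj)) hu _
  obtain ⟨s, hs, hsb⟩ := isRegularMod_localization_of_le_height (hdepth M) hht hy
    (fun P hP h => hJ.2.1.le_of_isPrime hker hf1 hπ hM h) i hb
  rw [hspan] at hsb
  exact hR.mem_span_of_mul_mem hd hπ hker hf1 hfd hM hg1 hg.2 hs hsb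

theorem analyticSpread_eq_of_ringKrullDim_eq {n : WithBot ℕ∞}
    (h : @ringKrullDim (SpecialFiber 𝒜 I) (Ideal.Quotient.commRing
      ((irrelevantIdeal 𝒜).map (algebraMap R (reesAlgebra I)))).toCommSemiring = n) :
    analyticSpread 𝒜 I = n := by
  rw [analyticSpread, ← h]

theorem ker_mk_map_irrelevantIdeal :
    RingHom.ker (Ideal.Quotient.mk ((irrelevantIdeal 𝒜).map (algebraMap R (reesAlgebra I)))) =
      (irrelevantIdeal 𝒜).map (algebraMap R (reesAlgebra I)) :=
  Ideal.mk_ker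

theorem IsMinimalReduction.analyticSpread_eq [Infinite k] (hR : IsStandardGraded 𝒜)
    (hd : IsEquigenerated 𝒜 I d) (hf : ∀ j, f j ∈ degPart 𝒜 I d)
    (hJ : IsMinimalReduction 𝒜 (Ideal.span (Set.range f)) I)
    (hl : l = minGens (Ideal.span (Set.range f))) : (l : WithBot ℕ∞) = analyticSpread 𝒜 I := by
  have h := @IsMinimalReduction.ringKrullDim_eq k R _ _ _ 𝒜 _ I (SpecialFiber 𝒜 I)
    (Ideal.Quotient.commRing ((irrelevantIdeal 𝒜).map (algebraMap R (reesAlgebra I))))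
    (Ideal.Quotient.mk ((irrelevantIdeal 𝒜).map (algebraMap R (reesAlgebra I)))) l d f _ hR hd
    Ideal.Quotient.mk_surjective
  have h' := h ker_mk_map_irrelevantIdeal
  exact (analyticSpread_eq_of_ringKrullDim_eq (h' (fun j => by rw [pow_one]; exact (hf j).1)
    (fun j => (hf j).2) hJ hl)).symm

theorem IsMinimalReduction.isAnalyticallyAdjusted [Infinite k] (hR : IsStandardGraded 𝒜)
    (hd : IsEquigenerated 𝒜 I d) (hCM : IsCohenMacaulayRing (SpecialFiber 𝒜 I))
    (hf : ∀ j, f j ∈ degPart 𝒜 I d)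
    (hJ : IsMinimalReduction 𝒜 (Ideal.span (Set.range f)) I)
    (hl : l = minGens (Ideal.span (Set.range f))) : IsAnalyticallyAdjusted 𝒜 I d f := by
  have h := @IsMinimalReduction.isAdjusted k R _ _ _ 𝒜 _ I (SpecialFiber 𝒜 I)
    (Ideal.Quotient.commRing ((irrelevantIdeal 𝒜).map (algebraMap R (reesAlgebra I))))
    (Ideal.Quotient.mk ((irrelevantIdeal 𝒜).map (algebraMap R (reesAlgebra I)))) l d f _ hR hd
    Ideal.Quotient.mk_surjective
  have h' := h ker_mk_map_irrelevantIdeal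
  exact ⟨hJ.analyticSpread_eq hR hd hf hl, h' hCM hf hJ hl⟩

/-- A k-basis of the span of the f_j generates J minimally, so its size μ(J) is the analytic spread,
which is l by assumption. -/
theorem IsMinimalReduction.eq_minGens_of_eq_analyticSpread [Infinite k]
    (hR : IsStandardGraded 𝒜) (hd : IsEquigenerated 𝒜 I d)
    (hf : ∀ j, f j ∈ degPart 𝒜 I d)
    (hJ : IsMinimalReduction 𝒜 (Ideal.span (Set.range f)) I)
    (hl : (l : WithBot ℕ∞) = analyticSpread 𝒜 I) :
    l = minGens (Ideal.span (Set.range f)) := by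
  set U := Submodule.span k (Set.range f) with hU
  have hUV : U ≤ degPart 𝒜 I d := Submodule.span_le.2 (by rintro _ ⟨j, rfl⟩; exact hf j)
  have hUfg : U.FG := Submodule.fg_span (Set.finite_range f)
  have : Module.Finite k U := Module.Finite.iff_fg.2 hUfg
  let b := Module.finBasis k U
  have hb : Submodule.span k (Set.range fun i => (b i : R)) = U := by
    have := congrArg (Submodule.map U.subtype) b.span_eq
    rwa [Submodule.map_span, ← Set.range_comp, Submodule.map_top, Submodule.range_subtype] at this
  have hspan : Ideal.span (Set.range fun i => (b i : R)) = Ideal.span (Set.range f) := by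
    rw [← Ideal.span_coe_span_eq (k := k), hb, hU, Ideal.span_coe_span_eq]
  have hmin : Module.finrank k U = minGens (Ideal.span (Set.range f)) := by
    rw [← hR.minGens_span (hUV.trans inf_le_right) hUfg, hU, Ideal.span_coe_span_eq]
  rw [← hspan] at hJ hmin
  have h := hJ.analyticSpread_eq hR hd (fun j => hUV (b j).2) hmin
  rw [← hspan, ← hmin]
  rw [← h] at hl
  exact_mod_cast hl

end AnalyticallyAdjusted

theorem mainTheorem7 {k R : Type*} [Field k] [Infinite k] [CommRing R] [Algebra k R]
    (𝒜 : ℕ → Submodule k R) [GradedAlgebra 𝒜] (hR : IsStandardGraded 𝒜)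
    (I : Ideal R) (hI : I ≤ irrelevantIdeal 𝒜) (d : ℕ) (hd : IsEquigenerated 𝒜 I d) :
    (∀ (l : ℕ) (f : Fin l → formAlgebra 𝒜 I d),
      (∀ j, (f j : R) ∈ degPart 𝒜 I d) →
      RingTheory.Sequence.IsRegular (formAlgebra 𝒜 I d) (List.ofFn f) →
      ∀ (i : ℕ) (_ : 1 ≤ i) (hil : i ≤ l),
        IsAdjusted 𝒜 I d (fun j : Fin i => (f (Fin.castLE hil j) : R))) ∧
    (IsCohenMacaulayRing (SpecialFiber 𝒜 I) →
      (∀ (l : ℕ) (f : Fin l → R),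
        (l : WithBot ℕ∞) = analyticSpread 𝒜 I →
        (∀ j, f j ∈ degPart 𝒜 I d) →
        IsMinimalReduction 𝒜 (Ideal.span (Set.range f)) I →
        IsAnalyticallyAdjusted 𝒜 I d f) ∧
      (∀ (l : ℕ) (f : Fin l → R),
        l = minGens (Ideal.span (Set.range f)) →
        (∀ j, f j ∈ degPart 𝒜 I d) →
        IsMinimalReduction 𝒜 (Ideal.span (Set.range f)) I →
        IsAnalyticallyAdjusted 𝒜 I d f)) := by
  refine ⟨fun l f hf hreg i _ hil => hR.isAdjusted_of_isRegular hd hf hreg hil, fun hCM => ⟨?_, ?_⟩⟩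
  · intro l f hl hf hJ
    exact hJ.isAnalyticallyAdjusted hR hd hCM hf
      (hJ.eq_minGens_of_eq_analyticSpread hR hd hf hl)
  · intro l f hl hf hJ
    exact hJ.isAnalyticallyAdjusted hR hd hCM hf hl
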